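/- Let $G=(-1,1)$ with the measure $dG(x)=\frac{dx}{1-x^2}$, let $t(x)=\frac12\ln\frac{1+x}{1-x}$ be the diffeomorphism $G\to\mathbb R$ with inverse $x(t)=\tanh t$, and put $(t_*\varphi)(x)=\varphi(t(x))$, $(x_*\varphi_0)(t)=\varphi_0(\tanh t)$. Let $\mathbb S(\mathbb R)$ be the (complex valued) Schwartz space and $\mathbb S(G)=t_*\mathbb S(\mathbb R)$. Set $$(\mathcal F\varphi)(\xi)=\int_{-\infty}^{\infty}e^{i\xi t}\varphi(t)\,dt,\qquad (\mathcal F^{-1}\psi)(t)=\frac1{2\pi}\int_{-\infty}^{\infty}e^{-i\xi t}\psi(\xi)\,d\xi,$$ $$(\mathcal F_Gv)(\xi)=\int_{-1}^{1}\Big(\frac{1+y}{1-y}\Big)^{i\xi}v(y)\,dG(y),\qquad (\mathcal F_G^{-1}\psi)(x)=\frac1{\pi}\int_{-\infty}^{\infty}\Big(\frac{1+x}{1-x}\Big)^{-i\xi}\psi(\xi)\,d\xi .$$ For a function $a:\mathbb R\to\mathbb C$ put $W^0_a=\mathcal F^{-1}a\mathcal F$ on $\mathbb S(\mathbb R)$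 and $W^0_{G,a}=\mathcal F_G^{-1}a\mathcal F_G$ on $\mathbb S(G)$. Such an operator is called defined if $a\,\mathcal F\varphi$ is integrable on $\mathbb R$ for all $\varphi\in\mathbb S(\mathbb R)$ (respectively $a\,\mathcal F_G\varphi_0$ for all $\varphi_0\in\mathbb S(G)$), and bounded on $L_p(\mathbb R)$ (respectively on $L_p(G,dG)$) if it is defined and there is a bounded linear operator on that $L_p$ space which coincides with it on the Schwartz space. The function $a$ is a Fourier $L_p(\mathbb R)$-multiplier, $a\in\mathfrak M_p(\mathbb R)$, if $W^0_a$ is bounded on $L_p(\mathbb R)$. **Theorem 3.2.** Let $a:\mathbb R\to\mathbb C$. (i) For every $1\le p\le\infty$, $W^0_{G,a}$ is bounded on $L_p(G,dG)$ if and only if $a\in\mathfrak M_p(\mathbb R)$. (ii) If $W^0_a$ is defined on $\mathbb S(\mathbb R)$ and $a_0(\xi)=a(2\xi)$, then $W^0_{G,a_0}$ is defined on $\mathbb S(G)$ and $W^0_{G,a_0}\varphi_0=t_*W^0_a x_*\varphi_0$ for all $\varphi_0\in\mathbb S(G)$. (iii) If $a$ has bounded variation on $\mathbb R$, then $W^0_{G,a}$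 is bounded on $L_p(G,dG)$ for every $1<p<\infty$. (iv) If $a$ belongs to the Wiener class, i.e. $a=c+\mathcal Fk$ with $c\in\mathbb C$ and $k\in L_1(\mathbb R)$, then $W^0_{G,a}$ is bounded on $L_p(G,dG)$ for every $1\le p\le\infty$. -/

import Mathlib

open MeasureTheory Set
open scoped SchwartzMap ENNReal

noncomputable section

/-- The interval `G = (-1, 1)`. -/
abbrev GInterval : Type := Set.Ioo (-1 : ℝ) 1

/-- The invariant measure `dG(x) = dx / (1 - x²)` on `G`. -/
def haarG : Measure GInterval :=
  ((volume : Measure ℝ).comap Subtype.val).withDensity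
    fun x : GInterval => ENNReal.ofReal (1 / (1 - (x : ℝ) ^ 2))

/-- The diffeomorphism `t : G → ℝ`, `t(x) = (1/2) ln ((1 + x) / (1 - x))`. -/
def tOfG (x : GInterval) : ℝ := 1 / 2 * Real.log ((1 + (x : ℝ)) / (1 - (x : ℝ)))

/-- The inverse diffeomorphism `x : ℝ → G`, `x(t) = tanh t`. -/
def xOfR (t : ℝ) : GInterval := ⟨Real.tanh t, Real.neg_one_lt_tanh t, Real.tanh_lt_one t⟩

/-- The pull back `(t_* φ)(x) = φ(t(x))`. -/
def tPull (φ : ℝ → ℂ) : GInterval → ℂ := fun x => φ (tOfG x)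

/-- The pull back `(x_* φ₀)(t) = φ₀(tanh t)`. -/
def xPull (φ₀ : GInterval → ℂ) : ℝ → ℂ := fun t => φ₀ (xOfR t)

/-- The Schwartz space `S(ℝ)`, as a set of functions. -/
def schwartzR : Set (ℝ → ℂ) := Set.range fun φ : 𝓢(ℝ, ℂ) => (φ : ℝ → ℂ)

/-- The Schwartz space `S(G)`, the image of `S(ℝ)` under `t_*`. -/
def schwartzG : Set (GInterval → ℂ) := tPull '' schwartzR

/-- The Fourier transformation on `ℝ`: `(F φ)(ξ) = ∫ e^{iξt} φ(t) dt`. -/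
def fourierR (φ : ℝ → ℂ) (ξ : ℝ) : ℂ :=
  ∫ t : ℝ, Complex.exp (Complex.I * ξ * t) * φ t

/-- The inverse transformation on `ℝ`: `(F⁻¹ ψ)(t) = (1/2π) ∫ e^{-iξt} ψ(ξ) dξ`. -/
def fourierInvR (ψ : ℝ → ℂ) (t : ℝ) : ℂ :=
  1 / (2 * (Real.pi : ℂ)) * ∫ ξ : ℝ, Complex.exp (-(Complex.I * ξ * t)) * ψ ξ

/-- The characters `C(x, ξ) = ((1 + x) / (1 - x))^{iξ}` of `G`. -/
def charG (x : GInterval) (ξ : ℝ) : ℂ :=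
  (((1 + (x : ℝ)) / (1 - (x : ℝ)) : ℝ) : ℂ) ^ (Complex.I * (ξ : ℂ))

/-- The Fourier transformation on `G`: `(F_G v)(ξ) = ∫_G C(y, ξ) v(y) dG(y)`. -/
def fourierG (v : GInterval → ℂ) (ξ : ℝ) : ℂ :=
  ∫ y : GInterval, charG y ξ * v y ∂haarG

/-- The inverse transformation on `G`:
`(F_G⁻¹ ψ)(x) = (1/π) ∫ ((1 + x) / (1 - x))^{-iξ} ψ(ξ) dξ`. -/
def fourierInvG (ψ : ℝ → ℂ) (x : GInterval) : ℂ :=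
  1 / (Real.pi : ℂ) * ∫ ξ : ℝ, charG x (-ξ) * ψ ξ

/-- The Fourier convolution `W⁰_a φ = F⁻¹ a F φ` on `ℝ`. -/
def convR (a : ℝ → ℂ) (φ : ℝ → ℂ) : ℝ → ℂ :=
  fourierInvR fun ξ => a ξ * fourierR φ ξ

/-- The convolution `W⁰_{G,a} φ₀ = F_G⁻¹ a F_G φ₀` on `G`. -/
def convG (a : ℝ → ℂ) (φ₀ : GInterval → ℂ) : GInterval → ℂ :=
  fourierInvG fun ξ => a ξ * fourierG φ₀ ξ

/-- The operator `F⁻¹ a F` is defined on `S(ℝ)`: the integral of the inverse transformation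
converges absolutely for every `φ ∈ S(ℝ)`. -/
def IsSymbolR (a : ℝ → ℂ) : Prop :=
  ∀ φ ∈ schwartzR, Integrable fun ξ : ℝ => a ξ * fourierR φ ξ

/-- The operator `F_G⁻¹ a F_G` is defined on `S(G)`. -/
def IsSymbolG (a : ℝ → ℂ) : Prop :=
  ∀ φ₀ ∈ schwartzG, Integrable fun ξ : ℝ => a ξ * fourierG φ₀ ξ

/-- An operator `W`, given on a set `S` of functions contained in `L_p(μ)`, extends to a bounded
linear operator `L_p(μ) → L_p(μ)`. -/
def ExtendsBoundedly {X : Type*} [MeasurableSpace X] (μ : Measure X) (p : ℝ≥0∞) [Fact (1 ≤ p)]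
    (S : Set (X → ℂ)) (W : (X → ℂ) → (X → ℂ)) : Prop :=
  ∃ T : Lp ℂ p μ →L[ℂ] Lp ℂ p μ, ∀ φ ∈ S, ∃ hφ : MemLp φ p μ, T (hφ.toLp φ) =ᵐ[μ] W φ

/-- `W⁰_{G,a}` is bounded on `L_p(G, dG)`. -/
def IsBoundedConvG (p : ℝ≥0∞) [Fact (1 ≤ p)] (a : ℝ → ℂ) : Prop :=
  IsSymbolG a ∧ ExtendsBoundedly haarG p schwartzG (convG a)

/-- The set `𝔐_p(ℝ)` of Fourier `L_p(ℝ)`-multipliers: the functions `a` for which `W⁰_a` is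
bounded on `L_p(ℝ)`. -/
def fourierMultipliers (p : ℝ≥0∞) [Fact (1 ≤ p)] : Set (ℝ → ℂ) :=
  {a | IsSymbolR a ∧ ExtendsBoundedly (volume : Measure ℝ) p schwartzR (convR a)}

/-- The Wiener class: the functions `a = c + F k` with `c ∈ ℂ` and `k ∈ L_1(ℝ)`. -/
def wienerClass : Set (ℝ → ℂ) :=
  {a | ∃ (c : ℂ) (k : ℝ → ℂ), Integrable k ∧ ∀ ξ : ℝ, a ξ = c + fourierR k ξ}

end

/-! The substitution x = tanh t carries dt to dG and the character ((1+x)/(1-x))^{iξ} to e^{2iξt}.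
Hence F_G φ₀ at ξ is the transform of x_*φ₀ at 2ξ, and W⁰_{G,a} is conjugate to the convolution on ℝ
with symbol a(ξ/2) (`convG_eq`, `isSymbolG_iff`). The conjugation is isometric on every L_p, and a
dilation of ℝ, which only multiplies norms by a constant, removes the factor 2;
`ExtendsBoundedly.transfer` serves both changes of variable. This yields (i) and (ii), and reduces
(iii) and (iv) to statements about multipliers on ℝ.

For the Wiener class, the symbol F k gives convolution with k, which Young's inequality bounds on
every L_p. For p < ∞ the operator is extended by density; for p = ∞ it is written down explicitly.

For bounded variation the core is the theorem of M. Riesz. If f ≥ 0 is not null, its Cauchy integral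
F has positive real part on the right half plane, so F^p is holomorphic there, and it decays fast
enough to have integral zero over vertical lines. Integrating |w|^p ≤ A (Re w)^p - B Re(w^p), valid
on the half plane for 1 < p ≤ 2, bounds F by Re F, a Poisson integral, which Young's inequality
controls. Linearity removes the sign condition and duality gives p > 2. The constants do not depend
on the line, so an Abel limit bounds the Fourier projection to (0,∞), and modulation bounds all half
line projections by one constant. A monotone function into [0,1] is a limit of averages of
indicators of upper sets and inherits that constant; a function of bounded variation is a
combination of bounded monotone ones. -/

open scoped FourierTransform

noncomputable section

/-! ### Young's inequality. -/

/-- Hölder's inequality against a weight. -/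
theorem lintegral_mul_rpow_le {K g : ℝ → ℝ≥0∞} (hK : Measurable K)
    (hg : Measurable g) {p : ℝ} (hp : 1 ≤ p) :
    (∫⁻ t, K t * g t) ^ p ≤ (∫⁻ t, K t) ^ (p - 1) * ∫⁻ t, K t * g t ^ p := by
  have hp0 : 0 < p := by linarith
  -- With K absorbed into the measure K dt, this is the comparison of the L¹ and Lᵖ norms on a space
  -- of total mass ∫ K.
  have h := eLpNorm'_le_eLpNorm'_mul_rpow_measure_univ (μ := volume.withDensity K) one_pos hp
    (f := g) hg.aestronglyMeasurable
  simp only [eLpNorm', enorm_eq_self, ENNReal.rpow_one, div_one, withDensity_apply _ MeasurableSet.univ,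
    Measure.restrict_univ] at h
  rw [lintegral_withDensity_eq_lintegral_mul _ hK hg,
    lintegral_withDensity_eq_lintegral_mul _ hK (hg.pow_const p)] at h
  have h2 := ENNReal.rpow_le_rpow h hp0.le
  rw [ENNReal.mul_rpow_of_nonneg _ _ hp0.le, ← ENNReal.rpow_mul, ← ENNReal.rpow_mul,
    one_div_mul_cancel hp0.ne', ENNReal.rpow_one] at h2
  have e : (1 - 1 / p) * p = p - 1 := by field_simp
  simp only [Pi.mul_apply] at h2
  rw [e, mul_comm] at h2
  exact h2

/-- **Young's inequality** for `L¹ * Lᵖ`, for nonnegative functions and finite `p`. -/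
theorem lintegral_conv_rpow_le {K g : ℝ → ℝ≥0∞} (hK : Measurable K)
    (hg : Measurable g) {p : ℝ} (hp : 1 ≤ p) :
    ∫⁻ x, (∫⁻ t, K t * g (x - t)) ^ p ≤ (∫⁻ t, K t) ^ p * ∫⁻ t, g t ^ p := by
  calc ∫⁻ x, (∫⁻ t, K t * g (x - t)) ^ p
      ≤ ∫⁻ x, (∫⁻ t, K t) ^ (p - 1) * ∫⁻ t, K t * g (x - t) ^ p :=
        lintegral_mono fun x => lintegral_mul_rpow_le hK
          (hg.comp (measurable_const.sub measurable_id)) hp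
    _ = (∫⁻ t, K t) ^ (p - 1) * ∫⁻ x, ∫⁻ t, K t * g (x - t) ^ p := by
        rw [lintegral_const_mul]
        exact Measurable.lintegral_prod_right' (f := fun z : ℝ × ℝ => K z.2 * g (z.1 - z.2) ^ p)
          (by fun_prop)
    _ = (∫⁻ t, K t) ^ (p - 1) * ((∫⁻ t, K t) * ∫⁻ t, g t ^ p) := by
        rw [lintegral_lintegral_swap (by fun_prop)]
        congr 1
        rw [← lintegral_mul_const _ hK]
        refine lintegral_congr fun t => ?_
        rw [lintegral_const_mul _ (by fun_prop), lintegral_sub_right_eq_self (fun x => g x ^ p) t]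
    _ = (∫⁻ t, K t) ^ p * ∫⁻ t, g t ^ p := by
        rw [← mul_assoc]
        congr 1
        have : p = (p - 1) + 1 := by ring
        conv_rhs => rw [this, ENNReal.rpow_add_of_nonneg _ _ (by linarith) zero_le_one,
          ENNReal.rpow_one]

/-- The integrand of the convolution only depends on the second factor up to null sets. -/
theorem ae_comp_sub_left {E : Type*} {g g' : ℝ → E} (h : g =ᵐ[volume] g') (x : ℝ) :
    (fun t => g (x - t)) =ᵐ[volume] fun t => g' (x - t) :=
  (Measure.measurePreserving_sub_left volume x).quasiMeasurePreserving.ae_eq_comp h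

/-- **Young's inequality** for `L¹ * Lᵖ`. -/
theorem eLpNorm_conv_le {k g : ℝ → ℂ} (hk : AEStronglyMeasurable k volume)
    (hg : AEStronglyMeasurable g volume) {p : ℝ≥0∞} (hp : 1 ≤ p) :
    eLpNorm (fun x => ∫ t, k t * g (x - t)) p ≤ (∫⁻ t, ‖k t‖ₑ) * eLpNorm g p := by
  rcases eq_or_ne p ∞ with rfl | hptop
  · rw [eLpNorm_exponent_top, eLpNorm_exponent_top]
    refine eLpNormEssSup_le_of_ae_enorm_bound (Filter.Eventually.of_forall fun x => ?_)
    refine (enorm_integral_le_lintegral_enorm _).trans ?_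
    rw [← lintegral_mul_const'' _ hk.enorm]
    refine lintegral_mono_ae ?_
    have h1 : ∀ᵐ t, ‖g (x - t)‖ₑ ≤ eLpNormEssSup g volume :=
      (Measure.measurePreserving_sub_left volume x).quasiMeasurePreserving.ae
        (ae_le_eLpNormEssSup (f := g))
    filter_upwards [h1] with t ht
    rw [enorm_mul]
    gcongr
  · have hp0 : p ≠ 0 := (zero_lt_one.trans_le hp).ne'
    have hpr : 1 ≤ p.toReal := by
      rw [← ENNReal.toReal_one]; exact ENNReal.toReal_mono hptop hp
    have hpr0 : 0 < p.toReal := by linarith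
    rw [eLpNorm_eq_lintegral_rpow_enorm_toReal hp0 hptop,
      eLpNorm_eq_lintegral_rpow_enorm_toReal hp0 hptop]
    have hk' := hk.stronglyMeasurable_mk
    have hg' := hg.stronglyMeasurable_mk
    have key := lintegral_conv_rpow_le (K := fun t => ‖hk.mk k t‖ₑ) (g := fun t => ‖hg.mk g t‖ₑ)
      hk'.enorm hg'.enorm hpr
    have e1 : ∫⁻ t, ‖hk.mk k t‖ₑ = ∫⁻ t, ‖k t‖ₑ :=
      lintegral_congr_ae (hk.ae_eq_mk.symm.fun_comp (‖·‖ₑ))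
    have e2 : ∫⁻ t, ‖hg.mk g t‖ₑ ^ p.toReal = ∫⁻ t, ‖g t‖ₑ ^ p.toReal :=
      lintegral_congr_ae (hg.ae_eq_mk.symm.fun_comp (fun z => ‖z‖ₑ ^ p.toReal))
    rw [e1, e2] at key
    have h3 : ∫⁻ x, ‖∫ t, k t * g (x - t)‖ₑ ^ p.toReal ≤
        (∫⁻ t, ‖k t‖ₑ) ^ p.toReal * ∫⁻ t, ‖g t‖ₑ ^ p.toReal := by
      refine le_trans (lintegral_mono fun x => ?_) key
      refine ENNReal.rpow_le_rpow ?_ hpr0.le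
      refine (enorm_integral_le_lintegral_enorm _).trans (le_of_eq ?_)
      refine lintegral_congr_ae ?_
      filter_upwards [hk.ae_eq_mk, ae_comp_sub_left hg.ae_eq_mk x] with t h1 h2
      rw [enorm_mul, h1, h2]
    refine (ENNReal.rpow_le_rpow h3 (by positivity)).trans (le_of_eq ?_)
    rw [ENNReal.mul_rpow_of_nonneg _ _ (by positivity), ← ENNReal.rpow_mul,
      mul_one_div_cancel hpr0.ne', ENNReal.rpow_one]

/-! ### The Cauchy integral on the right half plane. -/

/-- The Cauchy integral of a function on the imaginary axis, `F(w) = ∫ f(t) / (w - it) dt`. -/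
def cauchyHalf (f : ℝ → ℂ) (w : ℂ) : ℂ := ∫ t : ℝ, f t / (w - Complex.I * t)

theorem re_le_norm_sub_I_mul (w : ℂ) (t : ℝ) : w.re ≤ ‖w - Complex.I * t‖ := by
  refine le_trans (le_of_eq ?_) (Complex.re_le_norm _)
  simp

theorem sub_I_mul_ne_zero {w : ℂ} (hw : 0 < w.re) (t : ℝ) : w - Complex.I * t ≠ 0 := by
  rw [← norm_pos_iff]
  exact hw.trans_le (re_le_norm_sub_I_mul w t)

theorem norm_div_sub_I_mul_le {w : ℂ} {ε : ℝ} (hε : 0 < ε) (hw : ε ≤ w.re) (z : ℂ) (t : ℝ) :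
    ‖z / (w - Complex.I * t)‖ ≤ ‖z‖ / ε := by
  rw [norm_div]
  exact div_le_div_of_nonneg_left (norm_nonneg _) hε (hw.trans (re_le_norm_sub_I_mul w t))

theorem aestronglyMeasurable_cauchyHalf_integrand {f : ℝ → ℂ} (hf : AEStronglyMeasurable f volume)
    (w : ℂ) : AEStronglyMeasurable (fun t : ℝ => f t / (w - Complex.I * t)) volume := by
  have : Measurable fun t : ℝ => (w - Complex.I * t)⁻¹ := by fun_prop
  simp only [div_eq_mul_inv]
  exact hf.mul this.aestronglyMeasurable

theorem integrable_cauchyHalf_integrand {f : ℝ → ℂ} (hf : Integrable f) {w : ℂ} (hw : 0 < w.re) :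
    Integrable fun t : ℝ => f t / (w - Complex.I * t) := by
  refine Integrable.mono' (hf.norm.div_const w.re)
    (aestronglyMeasurable_cauchyHalf_integrand hf.1 w) (Filter.Eventually.of_forall fun t => ?_)
  exact norm_div_sub_I_mul_le hw le_rfl _ t

/-- The Cauchy integral is `O(1 / |w|)` on half planes `Re w ≥ ε`. -/
theorem norm_cauchyHalf_mul_le {f : ℝ → ℂ} (hf : Integrable f)
    (hf1 : Integrable fun t : ℝ => |t| * ‖f t‖) {ε : ℝ} (hε : 0 < ε) {w : ℂ} (hw : ε ≤ w.re) :
    ‖w‖ * ‖cauchyHalf f w‖ ≤ ∫ t : ℝ, (‖f t‖ + |t| * ‖f t‖ / ε) := by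
  have h0 : 0 < w.re := hε.trans_le hw
  rw [cauchyHalf, ← norm_mul, ← integral_const_mul]
  refine (norm_integral_le_integral_norm _).trans ?_
  refine integral_mono (((integrable_cauchyHalf_integrand hf h0).const_mul w).norm)
    (hf.norm.add (hf1.div_const ε)) fun t => ?_
  have hne := norm_pos_iff.2 (sub_I_mul_ne_zero h0 t)
  simp only [norm_mul, norm_div]
  -- The growth of w is split between the denominator, which cancels, and |t|, which the first
  -- moment of f absorbs.
  have h1 : ‖w‖ ≤ ‖w - Complex.I * t‖ + |t| := by
    have := norm_add_le (w - Complex.I * t) (Complex.I * t)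
    simpa using this
  have h2 := hw.trans (re_le_norm_sub_I_mul w t)
  have h3 : |t| / ‖w - Complex.I * t‖ ≤ |t| / ε :=
    div_le_div_of_nonneg_left (abs_nonneg t) hε h2
  calc ‖w‖ * (‖f t‖ / ‖w - Complex.I * t‖)
      = ‖f t‖ * (‖w‖ / ‖w - Complex.I * t‖) := by ring
    _ ≤ ‖f t‖ * ((‖w - Complex.I * t‖ + |t|) / ‖w - Complex.I * t‖) := by gcongr
    _ = ‖f t‖ * (1 + |t| / ‖w - Complex.I * t‖) := by rw [add_div, div_self hne.ne']
    _ ≤ ‖f t‖ * (1 + |t| / ε) := by gcongr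
    _ = ‖f t‖ + |t| * ‖f t‖ / ε := by ring

/-- The Cauchy integral is holomorphic on the right half plane. -/
theorem differentiableAt_cauchyHalf {f : ℝ → ℂ} (hf : Integrable f) {w : ℂ} (hw : 0 < w.re) :
    DifferentiableAt ℂ (cauchyHalf f) w := by
  have hopen : IsOpen {z : ℂ | w.re / 2 < z.re} := isOpen_lt continuous_const Complex.continuous_re
  have hs : {z : ℂ | w.re / 2 < z.re} ∈ nhds w := hopen.mem_nhds (by simp; linarith)
  have hpos : 0 < w.re / 2 := by linarith
  have := hasDerivAt_integral_of_dominated_loc_of_deriv_le (μ := volume) (𝕜 := ℂ)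
    (F := fun (z : ℂ) (t : ℝ) => f t / (z - Complex.I * t))
    (F' := fun (z : ℂ) (t : ℝ) => -(f t / (z - Complex.I * t) / (z - Complex.I * t)))
    (bound := fun t => ‖f t‖ / (w.re / 2) / (w.re / 2)) (x₀ := w) hs
    (Filter.Eventually.of_forall fun z => aestronglyMeasurable_cauchyHalf_integrand hf.1 z)
    (integrable_cauchyHalf_integrand hf hw)
    ((aestronglyMeasurable_cauchyHalf_integrand
      (aestronglyMeasurable_cauchyHalf_integrand hf.1 w) w).neg)
    (Filter.Eventually.of_forall fun t z hz => by
      rw [norm_neg]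
      refine (norm_div_sub_I_mul_le hpos (le_of_lt hz) _ t).trans ?_
      gcongr
      exact norm_div_sub_I_mul_le hpos (le_of_lt hz) _ t)
    ((hf.norm.div_const _).div_const _)
    (Filter.Eventually.of_forall fun t z hz => by
      have hne := sub_I_mul_ne_zero (hpos.trans hz) t
      have h := ((hasDerivAt_id z).sub_const (Complex.I * t)).fun_inv hne
      have h2 := h.const_mul (f t)
      simp only [id] at h2
      refine HasDerivAt.congr_deriv h2 ?_
      rw [div_div, ← pow_two, neg_div, mul_neg, mul_one_div])
  exact this.2.differentiableAt

theorem re_ofReal_div_sub_I_mul (r : ℝ) (w : ℂ) (t : ℝ) :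
    ((r : ℂ) / (w - Complex.I * t)).re = r * (w.re / (w.re ^ 2 + (w.im - t) ^ 2)) := by
  rw [Complex.div_re]
  simp [Complex.normSq_apply]
  ring

/-- The real part of the Cauchy integral of a real function is its Poisson integral. -/
theorem re_cauchyHalf_ofReal {f : ℝ → ℝ} (hf : Integrable f) {w : ℂ} (hw : 0 < w.re) :
    (cauchyHalf (fun t => (f t : ℂ)) w).re =
      ∫ t : ℝ, f t * (w.re / (w.re ^ 2 + (w.im - t) ^ 2)) := by
  have hfc : Integrable fun t => (f t : ℂ) := hf.ofReal
  have h := integral_re (𝕜 := ℂ) (integrable_cauchyHalf_integrand hfc hw)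
  simp only [RCLike.re_to_complex] at h
  rw [cauchyHalf, ← h]
  exact integral_congr_ae (Filter.Eventually.of_forall fun t => re_ofReal_div_sub_I_mul _ _ _)

/-- The Poisson kernel is strictly positive, so the integral can vanish only for a null f.
Consequently F avoids the cut of the principal branch and its power F^p is holomorphic. -/
theorem re_cauchyHalf_pos {f : ℝ → ℝ} (hf : Integrable f) (h0 : 0 ≤ f)
    (hne : ¬ f =ᵐ[volume] 0) {w : ℂ} (hw : 0 < w.re) :
    0 < (cauchyHalf (fun t => (f t : ℂ)) w).re := by
  have hint : Integrable fun t : ℝ => f t * (w.re / (w.re ^ 2 + (w.im - t) ^ 2)) := by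
    have h := (integrable_cauchyHalf_integrand hf.ofReal hw).re
    refine h.congr (Filter.Eventually.of_forall fun t => ?_)
    exact re_ofReal_div_sub_I_mul _ _ _
  have hker : ∀ t : ℝ, 0 < w.re / (w.re ^ 2 + (w.im - t) ^ 2) := fun t => by positivity
  rw [re_cauchyHalf_ofReal hf hw]
  refine lt_of_le_of_ne (integral_nonneg fun t => mul_nonneg (h0 t) (hker t).le) fun h => hne ?_
  have := (integral_eq_zero_iff_of_nonneg (fun t => mul_nonneg (h0 t) (hker t).le) hint).1 h.symm
  filter_upwards [this] with t ht
  simpa [(hker t).ne'] using ht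

/-! ### The pointwise inequality and Cauchy's theorem on vertical lines. -/

/-- The pointwise inequality behind the theorem of M. Riesz. -/
theorem exists_norm_rpow_le_re_rpow_sub {p : ℝ} (hp : 1 < p) (hp2 : p ≤ 2) :
    ∃ A B : ℝ, 0 ≤ A ∧ 0 ≤ B ∧ ∀ w : ℂ, 0 < w.re →
      ‖w‖ ^ p ≤ A * w.re ^ p - B * (w ^ (p : ℂ)).re := by
  have hp0 : 0 < p := by linarith
  have hpi := Real.pi_pos
  -- θ₀ is the midpoint of π/(2p) and π/2: it stays inside the half plane while p θ₀ passes π/2, so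
  -- that cos(p θ₀) < 0.
  set θ₀ : ℝ := (Real.pi / 2 + Real.pi / (2 * p)) / 2 with hθ₀
  have hpθ : p * θ₀ = (p * Real.pi / 2 + Real.pi / 2) / 2 := by rw [hθ₀]; field_simp
  have h1 : Real.pi / 2 < p * θ₀ := by rw [hpθ]; nlinarith
  have h2 : θ₀ < Real.pi / 2 := by nlinarith
  have h3 : 0 < θ₀ := by positivity
  set δ := -Real.cos (p * θ₀) with hδ
  have hδ0 : 0 < δ := by
    rw [hδ, neg_pos]
    exact Real.cos_neg_of_pi_div_two_lt_of_lt h1 (by nlinarith)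
  set γ := Real.cos θ₀ with hγ
  have hγ0 : 0 < γ := Real.cos_pos_of_mem_Ioo ⟨by linarith, h2⟩
  -- B = 1/δ makes the second term alone at least |w|^p when |arg w| ≥ θ₀. A then pays, in the
  -- sector |arg w| ≤ θ₀ where cos(arg w) ≥ γ, for |w|^p and for the possible loss B |w|^p.
  refine ⟨(1 + 1 / δ) / γ ^ p, 1 / δ, by positivity, by positivity, fun w hw => ?_⟩
  have hw0 : w ≠ 0 := by rintro rfl; simp at hw
  have hn : 0 < ‖w‖ := norm_pos_iff.2 hw0
  set θ := |Complex.arg w| with hθ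
  have hθ2 : θ < Real.pi / 2 := Complex.abs_arg_lt_pi_div_two_iff.2 (Or.inl hw)
  have hθn : 0 ≤ θ := abs_nonneg _
  have hre : w.re = ‖w‖ * Real.cos θ := by
    rw [hθ, Real.cos_abs, Complex.norm_mul_cos_arg]
  have hpow : (w ^ (p : ℂ)).re = ‖w‖ ^ p * Real.cos (p * θ) := by
    have := Complex.cpow_ofReal_re w p
    rw [this, mul_comm p θ]
    congr 1
    rcases abs_cases (Complex.arg w) with ⟨h, _⟩ | ⟨h, _⟩
    · rw [hθ, h]
    · rw [hθ, h, neg_mul, Real.cos_neg]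
  have hcos : 0 < Real.cos θ := Real.cos_pos_of_mem_Ioo ⟨by linarith, hθ2⟩
  rw [hpow, hre, Real.mul_rpow hn.le hcos.le]
  have hnp : 0 < ‖w‖ ^ p := by positivity
  suffices h : 1 ≤ (1 + 1 / δ) / γ ^ p * Real.cos θ ^ p - 1 / δ * Real.cos (p * θ) by
    calc ‖w‖ ^ p = ‖w‖ ^ p * 1 := by ring
      _ ≤ ‖w‖ ^ p * ((1 + 1 / δ) / γ ^ p * Real.cos θ ^ p - 1 / δ * Real.cos (p * θ)) := by
        gcongr
      _ = _ := by ring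
  rcases le_total θ θ₀ with hle | hle
  · have hc : γ ≤ Real.cos θ := Real.cos_le_cos_of_nonneg_of_le_pi hθn (by linarith) hle
    have hcp : γ ^ p ≤ Real.cos θ ^ p := Real.rpow_le_rpow hγ0.le hc hp0.le
    have h4 : 1 + 1 / δ ≤ (1 + 1 / δ) / γ ^ p * Real.cos θ ^ p := by
      rw [div_mul_eq_mul_div, le_div_iff₀ (by positivity)]
      gcongr
    have h5 : 1 / δ * Real.cos (p * θ) ≤ 1 / δ * 1 := by
      gcongr; exact Real.cos_le_one _
    linarith
  · have hc : Real.cos (p * θ) ≤ Real.cos (p * θ₀) :=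
      Real.cos_le_cos_of_nonneg_of_le_pi (by positivity) (by nlinarith) (by gcongr)
    have h4 : 1 ≤ - (1 / δ * Real.cos (p * θ)) := by
      rw [neg_mul_eq_mul_neg, one_div_mul_eq_div, le_div_iff₀ hδ0]
      linarith
    have : 0 ≤ (1 + 1 / δ) / γ ^ p * Real.cos θ ^ p := by positivity
    linarith

/-- The modulus dominates both ε and |x|, hence their mean; this allows comparison with the
integrable weight (1 + |x|)^{-p}. -/
theorem le_norm_add_mul_I {ε : ℝ} (hε : 0 < ε) (x : ℝ) :
    min ε 1 / 2 * (1 + ‖x‖) ≤ ‖(ε : ℂ) + x * Complex.I‖ := by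
  have h1 : ε ≤ ‖(ε : ℂ) + x * Complex.I‖ := by
    simpa using Complex.re_le_norm ((ε : ℂ) + x * Complex.I)
  have h2 : ‖x‖ ≤ ‖(ε : ℂ) + x * Complex.I‖ := by
    simpa using Complex.abs_im_le_norm ((ε : ℂ) + x * Complex.I)
  have h3 := min_le_left ε 1
  have h4 := min_le_right ε 1
  have h5 : 0 < min ε 1 := lt_min hε one_pos
  nlinarith [norm_nonneg x]

theorem integrable_norm_add_mul_I_rpow {ε p : ℝ} (hε : 0 < ε) (hp : 1 < p) :
    Integrable fun x : ℝ => ‖(ε : ℂ) + x * Complex.I‖ ^ (-p) := by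
  have hc : 0 < min ε 1 / 2 := half_pos (lt_min hε one_pos)
  have h := (integrable_one_add_norm (E := ℝ) (μ := volume) (r := p) (by simpa using hp)).const_mul
    ((min ε 1 / 2) ^ (-p))
  have hm : Measurable fun x : ℝ => ‖(ε : ℂ) + x * Complex.I‖ ^ (-p) := by fun_prop
  refine h.mono' hm.aestronglyMeasurable (Filter.Eventually.of_forall fun x => ?_)
  rw [Real.norm_of_nonneg (by positivity), ← Real.mul_rpow hc.le (by positivity)]
  exact Real.rpow_le_rpow_of_nonpos (by positivity) (le_norm_add_mul_I hε x) (by linarith)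

/-- Cauchy's theorem on a vertical line, for a holomorphic function decaying faster than `1/|w|`. -/
theorem integral_vertical_line_eq_zero {h : ℂ → ℂ} {ε p C : ℝ} (hε : 0 < ε) (hp : 1 < p)
    (hd : ∀ w : ℂ, 0 < w.re → DifferentiableAt ℂ h w)
    (hb : ∀ w : ℂ, ε ≤ w.re → ‖h w‖ ≤ C * ‖w‖ ^ (-p)) :
    Integrable (fun x : ℝ => h (ε + x * Complex.I)) ∧ ∫ x : ℝ, h (ε + x * Complex.I) = 0 := by
  have hcont : Continuous fun x : ℝ => h (ε + x * Complex.I) := by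
    rw [continuous_iff_continuousAt]
    intro x
    refine ContinuousAt.comp (f := fun x : ℝ => (ε : ℂ) + x * Complex.I) (g := h) ?_ (by fun_prop)
    exact (hd _ (by simpa using hε)).continuousAt
  have hint : Integrable (fun x : ℝ => h (ε + x * Complex.I)) :=
    ((integrable_norm_add_mul_I_rpow hε hp).const_mul C).mono' hcont.aestronglyMeasurable
      (Filter.Eventually.of_forall fun x => hb _ (by simp))
  refine ⟨hint, ?_⟩
  have hC : 0 ≤ C := by
    have h1 := (norm_nonneg _).trans (hb ε (by simp))
    have h2 : 0 < ‖(ε : ℂ)‖ ^ (-p) := by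
      apply Real.rpow_pos_of_pos; simpa using hε.ne'
    exact nonneg_of_mul_nonneg_left h1 h2
  have hlim1 := intervalIntegral_tendsto_integral (f := fun x : ℝ => h (ε + x * Complex.I)) hint
    Filter.tendsto_neg_atTop_atBot Filter.tendsto_id
  refine tendsto_nhds_unique hlim1 ?_
  -- The contour is the boundary of [ε, ε+R] × [-R, R]. Its three far sides have total length 4R,
  -- and the integrand is at most C R^{-p} on them.
  have hlim2 : Filter.Tendsto (fun R : ℝ => 4 * C * R ^ (-(p - 1))) Filter.atTop (nhds 0) := by
    simpa using (tendsto_rpow_neg_atTop (by linarith : 0 < p - 1)).const_mul (4 * C)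
  refine squeeze_zero_norm' ?_ hlim2
  filter_upwards [Filter.eventually_gt_atTop 0] with R hR
  have hrect := Complex.integral_boundary_rect_eq_zero_of_differentiableOn h
    (⟨ε, -R⟩ : ℂ) (⟨ε + R, R⟩ : ℂ) (fun w hw => by
      refine (hd w ?_).differentiableWithinAt
      rw [Complex.mem_reProdIm] at hw
      have := hw.1
      simp only at this
      rw [uIcc_of_le (by linarith)] at this
      linarith [this.1])
  simp only [id] at hrect ⊢
  have hbR : ∀ w : ℂ, ε ≤ w.re → R ≤ ‖w‖ → ‖h w‖ ≤ C * R ^ (-p) := fun w h1 h2 => by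
    refine (hb w h1).trans (mul_le_mul_of_nonneg_left ?_ hC)
    exact Real.rpow_le_rpow_of_nonpos hR h2 (by linarith)
  have b1 : ‖∫ x : ℝ in ε..ε + R, h (x + ((-R : ℝ) : ℂ) * Complex.I)‖ ≤ C * R ^ (-p) * |ε + R - ε| := by
    refine intervalIntegral.norm_integral_le_of_norm_le_const fun x hx => hbR _ ?_ ?_
    · rw [uIoc_of_le (by linarith)] at hx
      simpa using hx.1.le
    · have := Complex.abs_im_le_norm (x + ((-R : ℝ) : ℂ) * Complex.I)
      simp only [Complex.add_im, Complex.ofReal_im, Complex.mul_im, Complex.ofReal_re, Complex.I_re,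
        Complex.I_im, mul_one, mul_zero, add_zero, zero_add, abs_neg, abs_of_pos hR] at this
      exact this
  have b2 : ‖∫ x : ℝ in ε..ε + R, h (x + (R : ℂ) * Complex.I)‖ ≤ C * R ^ (-p) * |ε + R - ε| := by
    refine intervalIntegral.norm_integral_le_of_norm_le_const fun x hx => hbR _ ?_ ?_
    · rw [uIoc_of_le (by linarith)] at hx
      simpa using hx.1.le
    · have := Complex.abs_im_le_norm (x + (R : ℂ) * Complex.I)
      simp only [Complex.add_im, Complex.ofReal_im, Complex.mul_im, Complex.ofReal_re, Complex.I_re,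
        Complex.I_im, mul_one, mul_zero, add_zero, zero_add, abs_of_pos hR] at this
      exact this
  have b3 : ‖∫ y : ℝ in (-R)..R, h (((ε + R : ℝ) : ℂ) + y * Complex.I)‖ ≤ C * R ^ (-p) * |R - -R| := by
    refine intervalIntegral.norm_integral_le_of_norm_le_const fun x hx => hbR _ ?_ ?_
    · simpa using hR.le
    · have := Complex.re_le_norm (((ε + R : ℝ) : ℂ) + x * Complex.I)
      simp only [Complex.add_re, Complex.ofReal_re, Complex.mul_re, Complex.I_re, Complex.ofReal_im,
        Complex.I_im, mul_zero, zero_mul, sub_zero, add_zero] at this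
      linarith
  rw [abs_of_pos (by linarith)] at b1 b2 b3
  set I1 := ∫ x : ℝ in ε..ε + R, h (x + ((-R : ℝ) : ℂ) * Complex.I)
  set I2 := ∫ x : ℝ in ε..ε + R, h (x + (R : ℂ) * Complex.I)
  set I3 := ∫ y : ℝ in (-R)..R, h (((ε + R : ℝ) : ℂ) + y * Complex.I)
  set I4 := ∫ y : ℝ in (-R)..R, h (ε + y * Complex.I)
  have e : Complex.I * I4 = I1 - I2 + Complex.I * I3 := by
    simp only [smul_eq_mul] at hrect
    linear_combination -hrect
  have hn : ‖I4‖ = ‖I1 - I2 + Complex.I * I3‖ := by rw [← e, norm_mul, Complex.norm_I, one_mul]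
  have hn2 : ‖I4‖ ≤ ‖I1‖ + ‖I2‖ + ‖I3‖ := by
    rw [hn]
    refine (norm_add_le _ _).trans ?_
    rw [norm_mul, Complex.norm_I, one_mul]
    gcongr
    exact norm_sub_le _ _
  have hpw : R ^ (-p) * R = R ^ (-(p - 1)) := by
    nth_rewrite 2 [← Real.rpow_one R]
    rw [← Real.rpow_add hR]; congr 1; ring
  calc ‖I4‖ ≤ C * R ^ (-p) * (ε + R - ε) + C * R ^ (-p) * (ε + R - ε) + C * R ^ (-p) * (R - -R) :=
        hn2.trans (by gcongr)
    _ = 4 * C * (R ^ (-p) * R) := by ring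
    _ = _ := by rw [hpw]

/-! ### Poisson integrals and the theorem of M. Riesz for 1 < p ≤ 2. -/

theorem integral_poisson {ε : ℝ} (hε : 0 < ε) :
    Integrable (fun t : ℝ => ε / (ε ^ 2 + t ^ 2)) ∧ ∫ t : ℝ, ε / (ε ^ 2 + t ^ 2) = Real.pi := by
  have e : (fun t : ℝ => ε / (ε ^ 2 + t ^ 2)) = fun t : ℝ => ε⁻¹ * (1 + (t / ε) ^ 2)⁻¹ := by
    funext t
    field_simp
  rw [e]
  refine ⟨(integrable_inv_one_add_sq.comp_div hε.ne').const_mul _, ?_⟩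
  rw [integral_const_mul, Measure.integral_comp_div (fun t => (1 + t ^ 2)⁻¹) ε,
    integral_univ_inv_one_add_sq, abs_of_pos hε, smul_eq_mul, ← mul_assoc, inv_mul_cancel₀ hε.ne',
    one_mul]

theorem lintegral_poisson {ε : ℝ} (hε : 0 < ε) :
    ∫⁻ t : ℝ, ‖((ε / (ε ^ 2 + t ^ 2) : ℝ) : ℂ)‖ₑ = ENNReal.ofReal Real.pi := by
  rw [← (integral_poisson hε).2, ofReal_integral_eq_lintegral_ofReal (integral_poisson hε).1
    (Filter.Eventually.of_forall fun t => by positivity)]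
  refine lintegral_congr fun t => ?_
  rw [← ofReal_norm, Complex.norm_of_nonneg (by positivity)]

/-- On the line Re w = ε the real part is the convolution of f with ε/(ε² + t²), whose mass π does
not depend on ε; Young's inequality therefore gives a bound uniform in ε. -/
theorem eLpNorm_re_cauchyHalf_le {f : ℝ → ℝ} (hf : Integrable f) {ε : ℝ} (hε : 0 < ε) {p : ℝ≥0∞}
    (hp : 1 ≤ p) :
    eLpNorm (fun x : ℝ => (cauchyHalf (fun t => (f t : ℂ)) (ε + x * Complex.I)).re) p ≤
      ENNReal.ofReal Real.pi * eLpNorm f p := by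
  have hfc : Integrable fun t => (f t : ℂ) := hf.ofReal
  have h := eLpNorm_conv_le (k := fun t : ℝ => ((ε / (ε ^ 2 + t ^ 2) : ℝ) : ℂ))
    (integral_poisson hε).1.ofReal.1 hfc.1 hp
  rw [lintegral_poisson hε] at h
  refine le_trans (le_of_eq ?_) (h.trans (le_of_eq ?_))
  · refine eLpNorm_congr_norm_ae (Filter.Eventually.of_forall fun x => ?_)
    rw [re_cauchyHalf_ofReal hf (by simpa using hε)]
    rw [← integral_sub_left_eq_self _ volume x, ← Complex.norm_real, ← integral_complex_ofReal]
    congr 1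
    refine integral_congr_ae (Filter.Eventually.of_forall fun t => ?_)
    simp
    ring
  · congr 1
    exact eLpNorm_congr_norm_ae (Filter.Eventually.of_forall fun x => by simp)

theorem continuous_cauchyHalf_vertical {f : ℝ → ℂ} (hf : Integrable f) {ε : ℝ} (hε : 0 < ε) :
    Continuous fun x : ℝ => cauchyHalf f (ε + x * Complex.I) := by
  rw [continuous_iff_continuousAt]
  intro x
  refine ContinuousAt.comp (f := fun x : ℝ => (ε : ℂ) + x * Complex.I) (g := cauchyHalf f) ?_
    (by fun_prop)
  exact (differentiableAt_cauchyHalf hf (by simpa using hε)).continuousAt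

theorem norm_cauchyHalf_rpow_le {f : ℝ → ℂ} (hf : Integrable f)
    (hf1 : Integrable fun t : ℝ => |t| * ‖f t‖) {ε p : ℝ} (hε : 0 < ε) (hp : 0 ≤ p) {w : ℂ}
    (hw : ε ≤ w.re) :
    ‖cauchyHalf f w‖ ^ p ≤ (∫ t : ℝ, (‖f t‖ + |t| * ‖f t‖ / ε)) ^ p * ‖w‖ ^ (-p) := by
  have hw0 : 0 < ‖w‖ := (hε.trans_le hw).trans_le (Complex.re_le_norm w)
  have h := norm_cauchyHalf_mul_le hf hf1 hε hw
  have hM : 0 ≤ ∫ t : ℝ, (‖f t‖ + |t| * ‖f t‖ / ε) := integral_nonneg fun t => by positivity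
  rw [Real.rpow_neg hw0.le, ← div_eq_mul_inv, ← Real.div_rpow hM hw0.le]
  refine Real.rpow_le_rpow (norm_nonneg _) ?_ hp
  rw [le_div_iff₀ hw0, mul_comm]
  exact h

/-- Vertical restrictions of the Cauchy integral are `p`-integrable. -/
theorem integrable_norm_cauchyHalf_rpow {f : ℝ → ℂ} (hf : Integrable f)
    (hf1 : Integrable fun t : ℝ => |t| * ‖f t‖) {ε p : ℝ} (hε : 0 < ε) (hp : 1 < p) :
    Integrable fun x : ℝ => ‖cauchyHalf f (ε + x * Complex.I)‖ ^ p := by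
  have hm := (continuous_cauchyHalf_vertical hf hε).norm.rpow_const
    (fun x => Or.inr (by linarith : 0 ≤ p))
  refine ((integrable_norm_add_mul_I_rpow hε hp).const_mul
    ((∫ t : ℝ, (‖f t‖ + |t| * ‖f t‖ / ε)) ^ p)).mono' hm.aestronglyMeasurable
    (Filter.Eventually.of_forall fun x => ?_)
  rw [Real.norm_of_nonneg (by positivity)]
  exact norm_cauchyHalf_rpow_le hf hf1 hε (by linarith) (by simp)

theorem lintegral_enorm_rpow_eq {E : Type*} [NormedAddCommGroup E] {g : ℝ → E} {p : ℝ} (hp : 0 ≤ p)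
    (hg : Integrable fun x => ‖g x‖ ^ p) :
    ∫⁻ x, ‖g x‖ₑ ^ p = ENNReal.ofReal (∫ x, ‖g x‖ ^ p) := by
  rw [ofReal_integral_eq_lintegral_ofReal hg (Filter.Eventually.of_forall fun x => by positivity)]
  refine lintegral_congr fun x => ?_
  rw [← ofReal_norm, ENNReal.ofReal_rpow_of_nonneg (norm_nonneg _) hp]

/-- Integrating the pointwise inequality along a vertical line kills the holomorphic term Re(F^p)
and leaves ‖F‖_p^p ≤ A ‖Re F‖_p^p. The constant must precede ε, since ε later tends to 0. -/
theorem exists_eLpNorm_cauchyHalf_le_of_nonneg {p : ℝ} (hp : 1 < p) (hp2 : p ≤ 2) :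
    ∃ C : ℝ≥0∞, C ≠ ∞ ∧ ∀ ε : ℝ, 0 < ε → ∀ f : ℝ → ℝ, Integrable f →
      Integrable (fun t : ℝ => |t| * ‖f t‖) → 0 ≤ f →
      eLpNorm (fun x : ℝ => cauchyHalf (fun t => (f t : ℂ)) (ε + x * Complex.I)) (ENNReal.ofReal p) ≤
        C * eLpNorm f (ENNReal.ofReal p) := by
  have hp0 : 0 < p := by linarith
  obtain ⟨A, B, hA, hB, hAB⟩ := exists_norm_rpow_le_re_rpow_sub hp hp2
  refine ⟨ENNReal.ofReal A ^ (1 / p) * ENNReal.ofReal Real.pi,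
    ENNReal.mul_ne_top (ENNReal.rpow_ne_top_of_nonneg (by positivity) ENNReal.ofReal_ne_top)
      ENNReal.ofReal_ne_top, fun ε hε f hf hf1 h0 => ?_⟩
  -- For null f the Cauchy integral is 0, which lies outside the open half plane where the pointwise
  -- inequality holds.
  by_cases hne : f =ᵐ[volume] 0
  · have : (fun x : ℝ => cauchyHalf (fun t => (f t : ℂ)) (ε + x * Complex.I)) = fun _ => 0 := by
      funext x
      rw [cauchyHalf]
      refine integral_eq_zero_of_ae ?_
      filter_upwards [hne] with t ht
      simp [ht]
    rw [this, eLpNorm_zero']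
    exact zero_le
  have hfc : Integrable fun t => (f t : ℂ) := hf.ofReal
  have hfc1 : Integrable fun t : ℝ => |t| * ‖(f t : ℂ)‖ := by simpa using hf1
  set F := cauchyHalf (fun t => (f t : ℂ)) with hF
  have hpos : ∀ w : ℂ, 0 < w.re → 0 < (F w).re := fun w hw => re_cauchyHalf_pos hf h0 hne hw
  have hline : ∀ x : ℝ, 0 < ((ε : ℂ) + x * Complex.I).re := fun x => by simpa using hε
  obtain ⟨hint, hzero⟩ := integral_vertical_line_eq_zero (h := fun w => F w ^ (p : ℂ))
    (ε := ε) (p := p) (C := (∫ t : ℝ, (‖(f t : ℂ)‖ + |t| * ‖(f t : ℂ)‖ / ε)) ^ p) hε hp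
    (fun w hw => (differentiableAt_cauchyHalf hfc hw).cpow_const (Or.inl (hpos w hw)))
    (fun w hw => by
      have hn : F w ≠ 0 := fun h => by
        have := hpos w (hε.trans_le hw)
        rw [h] at this
        simp at this
      have e : ‖F w ^ (p : ℂ)‖ = ‖F w‖ ^ p := by
        rw [Complex.norm_cpow_of_ne_zero hn]; simp
      rw [e]
      exact norm_cauchyHalf_rpow_le hfc hfc1 hε hp0.le hw)
  have hzero_re : ∫ x : ℝ, (F (ε + x * Complex.I) ^ (p : ℂ)).re = 0 := by
    have := integral_re (𝕜 := ℂ) hint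
    simp only [RCLike.re_to_complex] at this
    rw [this, hzero, Complex.zero_re]
  have hFint := integrable_norm_cauchyHalf_rpow hfc hfc1 hε hp
  have hRint : Integrable fun x : ℝ => ‖(F (ε + x * Complex.I)).re‖ ^ p := by
    have hm := (Complex.continuous_re.comp (continuous_cauchyHalf_vertical hfc hε)).norm.rpow_const
      (fun x => Or.inr hp0.le)
    refine hFint.mono' hm.aestronglyMeasurable (Filter.Eventually.of_forall fun x => ?_)
    rw [Real.norm_of_nonneg (by positivity)]
    exact Real.rpow_le_rpow (norm_nonneg _) (Complex.abs_re_le_norm _) hp0.le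
  have hmain : ∫ x : ℝ, ‖F (ε + x * Complex.I)‖ ^ p ≤
      A * ∫ x : ℝ, ‖(F (ε + x * Complex.I)).re‖ ^ p := by
    have hre : Integrable fun x : ℝ => (F (ε + x * Complex.I) ^ (p : ℂ)).re := hint.re
    calc ∫ x : ℝ, ‖F (ε + x * Complex.I)‖ ^ p
        ≤ ∫ x : ℝ, (A * ‖(F (ε + x * Complex.I)).re‖ ^ p -
            B * (F (ε + x * Complex.I) ^ (p : ℂ)).re) := by
          refine integral_mono hFint ((hRint.const_mul A).sub (hre.const_mul B)) fun x => ?_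
          have h1 := hpos _ (hline x)
          have := hAB _ h1
          simp only [Real.norm_of_nonneg h1.le]
          exact this
      _ = A * ∫ x : ℝ, ‖(F (ε + x * Complex.I)).re‖ ^ p := by
          rw [integral_sub (hRint.const_mul A) (hre.const_mul B), integral_const_mul,
            integral_const_mul, hzero_re, mul_zero, sub_zero]
  have hP : ENNReal.ofReal p ≠ 0 := by simpa using hp0
  have step : eLpNorm (fun x : ℝ => F (ε + x * Complex.I)) (ENNReal.ofReal p) ≤
      ENNReal.ofReal A ^ (1 / p) *
        eLpNorm (fun x : ℝ => (F (ε + x * Complex.I)).re) (ENNReal.ofReal p) := by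
    rw [eLpNorm_eq_lintegral_rpow_enorm_toReal hP ENNReal.ofReal_ne_top,
      eLpNorm_eq_lintegral_rpow_enorm_toReal hP ENNReal.ofReal_ne_top,
      ENNReal.toReal_ofReal hp0.le, ← ENNReal.mul_rpow_of_nonneg _ _ (by positivity)]
    refine ENNReal.rpow_le_rpow ?_ (by positivity)
    rw [lintegral_enorm_rpow_eq hp0.le hFint, lintegral_enorm_rpow_eq hp0.le hRint,
      ← ENNReal.ofReal_mul hA]
    exact ENNReal.ofReal_le_ofReal hmain
  refine step.trans ?_
  rw [mul_assoc]
  gcongr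
  exact eLpNorm_re_cauchyHalf_le hf hε (by simpa using hp.le)

theorem cauchyHalf_add {f g : ℝ → ℂ} (hf : Integrable f) (hg : Integrable g) {w : ℂ}
    (hw : 0 < w.re) : cauchyHalf (fun t => f t + g t) w = cauchyHalf f w + cauchyHalf g w := by
  simp only [cauchyHalf, add_div]
  exact integral_add (integrable_cauchyHalf_integrand hf hw) (integrable_cauchyHalf_integrand hg hw)

theorem cauchyHalf_const_mul (c : ℂ) (f : ℝ → ℂ) (w : ℂ) :
    cauchyHalf (fun t => c * f t) w = c * cauchyHalf f w := by
  simp only [cauchyHalf, mul_div_assoc]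
  exact integral_const_mul _ _

/-- The positive and negative parts inherit integrability and the first moment, and each has norm at
most that of f; this is the source of the factor 2. -/
theorem exists_eLpNorm_cauchyHalf_le_of_real {p : ℝ} (hp : 1 < p) (hp2 : p ≤ 2) :
    ∃ C : ℝ≥0∞, C ≠ ∞ ∧ ∀ ε : ℝ, 0 < ε → ∀ f : ℝ → ℝ, Integrable f →
      Integrable (fun t : ℝ => |t| * ‖f t‖) →
      eLpNorm (fun x : ℝ => cauchyHalf (fun t => (f t : ℂ)) (ε + x * Complex.I)) (ENNReal.ofReal p) ≤
        C * eLpNorm f (ENNReal.ofReal p) := by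
  obtain ⟨C, hC, h⟩ := exists_eLpNorm_cauchyHalf_le_of_nonneg hp hp2
  refine ⟨2 * C, ENNReal.mul_ne_top (by simp) hC, fun ε hε f hf hf1 => ?_⟩
  have hpos : ∀ g : ℝ → ℝ, Integrable g → Integrable (fun t : ℝ => |t| * ‖g t‖) →
      Integrable (fun t => max (g t) 0) ∧ Integrable (fun t : ℝ => |t| * ‖max (g t) 0‖) ∧
      eLpNorm (fun t => max (g t) 0) (ENNReal.ofReal p) ≤ eLpNorm g (ENNReal.ofReal p) := by
    intro g hg hg1
    have hle : ∀ t, ‖max (g t) 0‖ ≤ ‖g t‖ := fun t => by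
      rw [Real.norm_of_nonneg (le_max_right _ _)]
      exact max_le (Real.le_norm_self _) (norm_nonneg _)
    have hi : Integrable (fun t => max (g t) 0) := hg.pos_part
    refine ⟨hi, ?_, eLpNorm_mono hle⟩
    refine hg1.mono' ((by fun_prop : Continuous fun t : ℝ => |t|).aestronglyMeasurable.mul hi.1.norm)
      (Filter.Eventually.of_forall fun t => ?_)
    simp only [norm_mul, Real.norm_eq_abs, abs_abs]
    exact mul_le_mul_of_nonneg_left (hle t) (abs_nonneg t)
  obtain ⟨a1, a2, a3⟩ := hpos f hf hf1
  obtain ⟨b1, b2, b3⟩ := hpos (fun t => -f t) hf.neg (by simpa using hf1)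
  have b3' : eLpNorm (fun t => max (-f t) 0) (ENNReal.ofReal p) ≤ eLpNorm f (ENNReal.ofReal p) :=
    b3.trans (le_of_eq (eLpNorm_congr_norm_ae (Filter.Eventually.of_forall fun x => by simp)))
  have c1 : Integrable fun t => ((max (f t) 0 : ℝ) : ℂ) := a1.ofReal
  have c2 : Integrable fun t => ((max (-f t) 0 : ℝ) : ℂ) := b1.ofReal
  have e : (fun x : ℝ => cauchyHalf (fun t => (f t : ℂ)) (ε + x * Complex.I)) =
      (fun x : ℝ => cauchyHalf (fun t => ((max (f t) 0 : ℝ) : ℂ)) (ε + x * Complex.I)) +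
      fun x : ℝ => -cauchyHalf (fun t => ((max (-f t) 0 : ℝ) : ℂ)) (ε + x * Complex.I) := by
    funext x
    have := cauchyHalf_add c1 (c2.const_mul (-1)) (w := ε + x * Complex.I) (by simpa using hε)
    rw [cauchyHalf_const_mul] at this
    simp only [Pi.add_apply]
    rw [← neg_one_mul, ← this]
    congr 1
    funext t
    rw [neg_one_mul, ← sub_eq_add_neg, ← Complex.ofReal_sub]
    congr 1
    rcases le_total 0 (f t) with h | h <;> simp [h]
  rw [e]
  refine (eLpNorm_add_le (continuous_cauchyHalf_vertical c1 hε).aestronglyMeasurable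
    (continuous_cauchyHalf_vertical c2 hε).neg.aestronglyMeasurable (by simpa using hp.le)).trans ?_
  rw [eLpNorm_neg, mul_assoc, two_mul]
  gcongr
  · exact (h ε hε _ a1 a2 fun t => le_max_right _ _).trans (by gcongr)
  · exact (h ε hε _ b1 b2 fun t => le_max_right _ _).trans (by gcongr)

/-- The theorem of M. Riesz for the Cauchy integral, `1 < p ≤ 2`. -/
theorem exists_eLpNorm_cauchyHalf_le_of_le_two {p : ℝ} (hp : 1 < p) (hp2 : p ≤ 2) :
    ∃ C : ℝ≥0∞, C ≠ ∞ ∧ ∀ ε : ℝ, 0 < ε → ∀ f : ℝ → ℂ, Integrable f →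
      Integrable (fun t : ℝ => |t| * ‖f t‖) →
      eLpNorm (fun x : ℝ => cauchyHalf f (ε + x * Complex.I)) (ENNReal.ofReal p) ≤
        C * eLpNorm f (ENNReal.ofReal p) := by
  obtain ⟨C, hC, h⟩ := exists_eLpNorm_cauchyHalf_le_of_real hp hp2
  refine ⟨2 * C, ENNReal.mul_ne_top (by simp) hC, fun ε hε f hf hf1 => ?_⟩
  have hcont : Continuous fun t : ℝ => |t| := by fun_prop
  have a1 : Integrable fun t => (f t).re := hf.re
  have b1 : Integrable fun t => (f t).im := hf.im
  have a2 : Integrable fun t : ℝ => |t| * ‖(f t).re‖ :=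
    hf1.mono' (hcont.aestronglyMeasurable.mul a1.1.norm) (Filter.Eventually.of_forall fun t => by
      simp only [norm_mul, Real.norm_eq_abs, abs_abs]
      exact mul_le_mul_of_nonneg_left (Complex.abs_re_le_norm _) (abs_nonneg t))
  have b2 : Integrable fun t : ℝ => |t| * ‖(f t).im‖ :=
    hf1.mono' (hcont.aestronglyMeasurable.mul b1.1.norm) (Filter.Eventually.of_forall fun t => by
      simp only [norm_mul, Real.norm_eq_abs, abs_abs]
      exact mul_le_mul_of_nonneg_left (Complex.abs_im_le_norm _) (abs_nonneg t))
  have a3 : eLpNorm (fun t => (f t).re) (ENNReal.ofReal p) ≤ eLpNorm f (ENNReal.ofReal p) :=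
    eLpNorm_mono fun t => Complex.abs_re_le_norm _
  have b3 : eLpNorm (fun t => (f t).im) (ENNReal.ofReal p) ≤ eLpNorm f (ENNReal.ofReal p) :=
    eLpNorm_mono fun t => Complex.abs_im_le_norm _
  have c1 : Integrable fun t => ((f t).re : ℂ) := a1.ofReal
  have c2 : Integrable fun t => ((f t).im : ℂ) := b1.ofReal
  have e : (fun x : ℝ => cauchyHalf f (ε + x * Complex.I)) =
      (fun x : ℝ => cauchyHalf (fun t => ((f t).re : ℂ)) (ε + x * Complex.I)) +
      fun x : ℝ => Complex.I * cauchyHalf (fun t => ((f t).im : ℂ)) (ε + x * Complex.I) := by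
    funext x
    simp only [Pi.add_apply]
    rw [← cauchyHalf_const_mul, ← cauchyHalf_add c1 (c2.const_mul _) (by simpa using hε)]
    congr 1
    funext t
    rw [mul_comm, Complex.re_add_im]
  have hm2 := (continuous_cauchyHalf_vertical c2 hε).aestronglyMeasurable (μ := volume)
  rw [e]
  refine (eLpNorm_add_le (continuous_cauchyHalf_vertical c1 hε).aestronglyMeasurable
    (hm2.const_mul _) (by simpa using hp.le)).trans ?_
  have en : eLpNorm (fun x : ℝ => Complex.I * cauchyHalf (fun t => ((f t).im : ℂ))
      (ε + x * Complex.I)) (ENNReal.ofReal p) =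
      eLpNorm (fun x : ℝ => cauchyHalf (fun t => ((f t).im : ℂ)) (ε + x * Complex.I))
        (ENNReal.ofReal p) :=
    eLpNorm_congr_norm_ae (Filter.Eventually.of_forall fun x => by simp)
  rw [en, mul_assoc, two_mul]
  gcongr
  · exact (h ε hε _ a1 a2).trans (by gcongr)
  · exact (h ε hε _ b1 b2).trans (by gcongr)

/-! ### Duality and the theorem of M. Riesz for 2 < p < ∞. -/

/-- The transpose of the Cauchy integral is its reflection. -/
theorem integral_cauchyHalf_mul {f ψ : ℝ → ℂ} (hf : Integrable f) (hψ : Integrable ψ) {ε : ℝ}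
    (hε : 0 < ε) :
    ∫ x : ℝ, cauchyHalf f (ε + x * Complex.I) * ψ x =
      ∫ t : ℝ, f t * cauchyHalf (fun y => ψ (-y)) (ε + (-t : ℝ) * Complex.I) := by
  have hint : Integrable (fun z : ℝ × ℝ =>
      f z.2 / ((ε + z.1 * Complex.I) - Complex.I * z.2) * ψ z.1) (volume.prod volume) := by
    have h := (hψ.mul_prod hf).norm.div_const ε
    refine h.mono' ?_ (Filter.Eventually.of_forall fun z => ?_)
    · have hm : Measurable fun z : ℝ × ℝ => ((ε + z.1 * Complex.I) - Complex.I * z.2 : ℂ)⁻¹ := by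
        fun_prop
      simp only [div_eq_mul_inv]
      exact (hf.1.comp_snd.mul hm.aestronglyMeasurable).mul hψ.1.comp_fst
    · rw [norm_mul, norm_mul, mul_comm ‖ψ z.1‖, mul_div_right_comm]
      gcongr
      exact norm_div_sub_I_mul_le hε (by simp) _ _
  calc ∫ x : ℝ, cauchyHalf f (ε + x * Complex.I) * ψ x
      = ∫ x : ℝ, ∫ t : ℝ, f t / ((ε + x * Complex.I) - Complex.I * t) * ψ x := by
        refine integral_congr_ae (Filter.Eventually.of_forall fun x => ?_)
        simp only [cauchyHalf]
        rw [integral_mul_const]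
    _ = ∫ t : ℝ, ∫ x : ℝ, f t / ((ε + x * Complex.I) - Complex.I * t) * ψ x :=
        integral_integral_swap hint
    _ = _ := by
        refine integral_congr_ae (Filter.Eventually.of_forall fun t => ?_)
        simp only [cauchyHalf]
        -- The kernel 1/(ε + i(x - t)) depends only on x - t, so x ↦ -x turns integration in x into
        -- a Cauchy integral at the reflected point ε - it.
        rw [← integral_const_mul, ← integral_neg_eq_self]
        refine integral_congr_ae (Filter.Eventually.of_forall fun x => ?_)
        simp only [Complex.ofReal_neg]
        have : (ε : ℂ) + -x * Complex.I - Complex.I * t = ε + -t * Complex.I - Complex.I * x := by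
          ring
        rw [this]
        ring

theorem lintegral_enorm_mul_le_eLpNorm_mul {p q : ℝ} (hpq : p.HolderConjugate q) {f g : ℝ → ℂ}
    (hf : AEStronglyMeasurable f volume) (hg : AEStronglyMeasurable g volume) :
    ∫⁻ t, ‖f t * g t‖ₑ ≤ eLpNorm f (ENNReal.ofReal p) * eLpNorm g (ENNReal.ofReal q) := by
  have h := ENNReal.lintegral_mul_le_Lp_mul_Lq volume hpq hf.enorm hg.enorm
  rw [eLpNorm_eq_lintegral_rpow_enorm_toReal (by simpa using hpq.pos) ENNReal.ofReal_ne_top,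
    eLpNorm_eq_lintegral_rpow_enorm_toReal (by simpa using hpq.symm.pos) ENNReal.ofReal_ne_top,
    ENNReal.toReal_ofReal hpq.nonneg, ENNReal.toReal_ofReal hpq.symm.nonneg]
  simpa only [enorm_mul, Pi.mul_apply] using h

theorem eLpNorm_comp_neg {f : ℝ → ℂ} (hf : AEStronglyMeasurable f volume) (p : ℝ≥0∞) :
    eLpNorm (fun t => f (-t)) p = eLpNorm f p :=
  eLpNorm_comp_measurePreserving (f := fun t : ℝ => -t) hf (Measure.measurePreserving_neg volume)

/-- A compactly supported function which norms a continuous function on a bounded interval. -/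
theorem exists_norming {p q : ℝ} (hpq : p.HolderConjugate q) (hp : 2 < p) {g : ℝ → ℂ}
    (hgc : Continuous g) (a b : ℝ) :
    ∃ ψ : ℝ → ℂ, Integrable ψ ∧ Integrable (fun t : ℝ => |t| * ‖ψ t‖) ∧
      eLpNorm ψ (ENNReal.ofReal q) = (∫⁻ x in Icc a b, ‖g x‖ₑ ^ p) ^ (1 / q) ∧
      ∫⁻ x in Icc a b, ‖g x‖ₑ ^ p = ‖∫ x : ℝ, g x * ψ x‖ₑ := by
  have hp0 : 0 < p := hpq.pos
  have hq0 : 0 < q := hpq.symm.pos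
  have hgp : Continuous fun x => ‖g x‖ ^ p := hgc.norm.rpow_const fun x => Or.inr hp0.le
  have hNint : IntegrableOn (fun x => ‖g x‖ ^ p) (Icc a b) := hgp.continuousOn.integrableOn_Icc
  have hNeq : ∫⁻ x in Icc a b, ‖g x‖ₑ ^ p = ENNReal.ofReal (∫ x in Icc a b, ‖g x‖ ^ p) := by
    rw [ofReal_integral_eq_lintegral_ofReal hNint
      (Filter.Eventually.of_forall fun x => by positivity)]
    refine lintegral_congr fun x => ?_
    rw [← ofReal_norm, ENNReal.ofReal_rpow_of_nonneg (norm_nonneg _) hp0.le]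
  obtain ⟨u, huc, hun, hgu⟩ : ∃ u : ℝ → ℂ, Continuous u ∧ (∀ x, ‖u x‖ ^ q = ‖g x‖ ^ p) ∧
      ∀ x, g x * u x = ((‖g x‖ ^ p : ℝ) : ℂ) := by
    -- This is the extremal function in Hölder's inequality; p > 2 makes it continuous at the zeros
    -- of g too.
    refine ⟨fun x => (starRingEnd ℂ) (g x) * ((‖g x‖ ^ (p - 2) : ℝ) : ℂ), ?_, fun x => ?_,
      fun x => ?_⟩
    · refine (Complex.continuous_conj.comp hgc).mul (Complex.continuous_ofReal.comp ?_)
      exact hgc.norm.rpow_const fun x => Or.inr (by linarith)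
    · have h1 : ‖(starRingEnd ℂ) (g x) * ((‖g x‖ ^ (p - 2) : ℝ) : ℂ)‖ = ‖g x‖ ^ (p - 1) := by
        rw [norm_mul, RCLike.norm_conj, Complex.norm_of_nonneg (by positivity)]
        have : p - 1 = 1 + (p - 2) := by ring
        rw [this, Real.rpow_add_of_nonneg (norm_nonneg _) zero_le_one (by linarith),
          Real.rpow_one]
      rw [h1, ← Real.rpow_mul (norm_nonneg _), hpq.sub_one_mul_conj]
    · rw [← mul_assoc, Complex.mul_conj, ← Complex.ofReal_mul, Complex.normSq_eq_norm_sq]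
      congr 1
      have : p = 2 + (p - 2) := by ring
      conv_rhs => rw [this, Real.rpow_add_of_nonneg (norm_nonneg _) zero_le_two (by linarith)]
      norm_num
  refine ⟨(Icc a b).indicator u, ?_, ?_, ?_, ?_⟩
  · rw [integrable_indicator_iff measurableSet_Icc]
    exact huc.continuousOn.integrableOn_Icc
  · have : (fun t : ℝ => |t| * ‖(Icc a b).indicator u t‖) =
        (Icc a b).indicator (fun s => |s| * ‖u s‖) := by
      funext t
      by_cases h : t ∈ Icc a b
      · simp only [h, indicator_of_mem]
      · simp only [h, not_false_eq_true, indicator_of_notMem, norm_zero, mul_zero]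
    rw [this, integrable_indicator_iff measurableSet_Icc]
    exact (continuous_abs.mul huc.norm).continuousOn.integrableOn_Icc
  · rw [eLpNorm_indicator_eq_eLpNorm_restrict measurableSet_Icc,
      eLpNorm_eq_lintegral_rpow_enorm_toReal (by simpa using hq0) ENNReal.ofReal_ne_top,
      ENNReal.toReal_ofReal hq0.le]
    congr 1
    refine lintegral_congr fun x => ?_
    rw [← ofReal_norm, ENNReal.ofReal_rpow_of_nonneg (norm_nonneg _) hq0.le, hun,
      ← ofReal_norm, ENNReal.ofReal_rpow_of_nonneg (norm_nonneg _) hp0.le]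
  · have : (fun x => g x * (Icc a b).indicator u x) = (Icc a b).indicator
        fun x => ((‖g x‖ ^ p : ℝ) : ℂ) := by
      funext x
      by_cases h : x ∈ Icc a b
      · simp only [h, indicator_of_mem, hgu]
      · simp only [h, not_false_eq_true, indicator_of_notMem, mul_zero]
    rw [this, integral_indicator measurableSet_Icc, integral_complex_ofReal, hNeq,
      ← ofReal_norm, Complex.norm_of_nonneg (integral_nonneg fun x => by positivity)]

/-- The theorem of M. Riesz for the Cauchy integral, `2 < p < ∞`, by duality. -/
theorem exists_eLpNorm_cauchyHalf_le_of_two_lt {p : ℝ} (hp : 2 < p) :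
    ∃ C : ℝ≥0∞, C ≠ ∞ ∧ ∀ ε : ℝ, 0 < ε → ∀ f : ℝ → ℂ, Integrable f →
      Integrable (fun t : ℝ => |t| * ‖f t‖) →
      eLpNorm (fun x : ℝ => cauchyHalf f (ε + x * Complex.I)) (ENNReal.ofReal p) ≤
        C * eLpNorm f (ENNReal.ofReal p) := by
  obtain ⟨q, hpq⟩ : ∃ q, p.HolderConjugate q :=
    ⟨_, Real.HolderConjugate.conjExponent (by linarith)⟩
  have hq2 : q ≤ 2 := by
    rw [hpq.conjugate_eq, div_le_iff₀ (by linarith)]; linarith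
  have hp0 : 0 < p := hpq.pos
  have hq0 : 0 < q := hpq.symm.pos
  obtain ⟨C, hC, hbound⟩ := exists_eLpNorm_cauchyHalf_le_of_le_two hpq.symm.lt hq2
  refine ⟨C, hC, fun ε hε f hf hf1 => ?_⟩
  have hgc := continuous_cauchyHalf_vertical hf hε
  have hgint := integrable_norm_cauchyHalf_rpow hf hf1 hε hpq.lt
  generalize hg : (fun x : ℝ => cauchyHalf f (ε + x * Complex.I)) = g at hgc
  have hgx : ∀ x : ℝ, cauchyHalf f (ε + x * Complex.I) = g x := fun x => congrFun hg x
  simp only [hgx] at hgint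
  have hloc : ∀ n : ℕ, (∫⁻ x in Icc (-(n : ℝ)) n, ‖g x‖ₑ ^ p) ^ (1 / p) ≤
      C * eLpNorm f (ENNReal.ofReal p) := by
    intro n
    obtain ⟨ψ, hψi, hψ1, hψnorm, hpair⟩ := exists_norming hpq hp hgc (-(n : ℝ)) n
    -- Finiteness, known only qualitatively and with a bound depending on ε, is what permits the
    -- cancellation below.
    have hfin : ∫⁻ x in Icc (-(n : ℝ)) n, ‖g x‖ₑ ^ p ≠ ∞ := by
      refine ((setLIntegral_le_lintegral _ _).trans_lt ?_).ne
      rw [lintegral_enorm_rpow_eq hp0.le hgint]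
      exact ENNReal.ofReal_lt_top
    generalize ∫⁻ x in Icc (-(n : ℝ)) n, ‖g x‖ₑ ^ p = N at hψnorm hpair hfin
    have hψi' : Integrable fun t => ψ (-t) := hψi.comp_neg
    have hψ1' : Integrable fun t : ℝ => |t| * ‖ψ (-t)‖ := by
      simpa using hψ1.comp_neg
    have hGc := continuous_cauchyHalf_vertical hψi' hε
    have hGn := hbound ε hε _ hψi' hψ1'
    have htrans := integral_cauchyHalf_mul hf hψi hε
    simp only [hgx] at htrans
    generalize hG : (fun x : ℝ => cauchyHalf (fun y => ψ (-y)) (ε + x * Complex.I)) = G at hGc hGn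
    have hGx : ∀ x : ℝ, cauchyHalf (fun y => ψ (-y)) (ε + x * Complex.I) = G x :=
      fun x => congrFun hG x
    simp only [hGx] at htrans
    rw [eLpNorm_comp_neg hψi.1, hψnorm] at hGn
    have hGm : AEStronglyMeasurable (fun t : ℝ => G (-t)) volume :=
      (hGc.comp continuous_neg).aestronglyMeasurable
    have hH := lintegral_enorm_mul_le_eLpNorm_mul hpq hf.1 hGm
    have hle : N ≤ C * eLpNorm f (ENNReal.ofReal p) * N ^ (1 / q) := by
      rw [htrans] at hpair
      rw [eLpNorm_comp_neg hGc.aestronglyMeasurable] at hH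
      refine hpair.trans_le ((enorm_integral_le_lintegral_enorm _).trans (hH.trans ?_))
      rw [mul_comm C, mul_assoc]
      gcongr
    -- Since N = N^{1/p} N^{1/q}, cancelling the finite nonzero factor N^{1/q} leaves the wanted
    -- bound for N^{1/p}.
    rcases eq_or_ne N 0 with h0 | h0
    · rw [h0, ENNReal.zero_rpow_of_pos (by positivity)]
      exact zero_le
    · have hsplit : N = N ^ (1 / p) * N ^ (1 / q) := by
        rw [← ENNReal.rpow_add _ _ h0 hfin, one_div, one_div, hpq.inv_add_inv_eq_one,
          ENNReal.rpow_one]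
      have hq1 : N ^ (1 / q) ≠ 0 := by
        rw [ne_eq, ENNReal.rpow_eq_zero_iff]
        push Not
        exact ⟨fun h => absurd h h0, fun h => absurd h hfin⟩
      have hq3 : N ^ (1 / q) ≠ ∞ := ENNReal.rpow_ne_top_of_nonneg (by positivity) hfin
      refine (ENNReal.mul_le_mul_iff_left hq1 hq3).1 ?_
      rw [← hsplit]
      exact hle
  rw [eLpNorm_eq_lintegral_rpow_enorm_toReal (by simpa using hp0) ENNReal.ofReal_ne_top,
    ENNReal.toReal_ofReal hp0.le]
  -- The bound on [-n, n] does not depend on n, so it passes to the whole line.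
  have hcov := aecover_Icc (μ := (volume : Measure ℝ)) (ι := ℕ) (a := fun n => -(n : ℝ))
    (b := fun n => (n : ℝ)) (l := Filter.atTop)
    (Filter.tendsto_neg_atTop_atBot.comp tendsto_natCast_atTop_atTop) tendsto_natCast_atTop_atTop
  have hlim := hcov.lintegral_tendsto_of_countably_generated (f := fun x => ‖g x‖ₑ ^ p)
    (hgc.measurable.enorm.pow_const p).aemeasurable
  exact le_of_tendsto' ((ENNReal.continuous_rpow_const.tendsto _).comp hlim) hloc

/-- The theorem of M. Riesz for the Cauchy integral, `1 < p < ∞`. -/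
theorem exists_eLpNorm_cauchyHalf_le {p : ℝ≥0∞} (hp : 1 < p) (hp' : p < ∞) :
    ∃ C : ℝ≥0∞, C ≠ ∞ ∧ ∀ ε : ℝ, 0 < ε → ∀ f : ℝ → ℂ, Integrable f →
      Integrable (fun t : ℝ => |t| * ‖f t‖) →
      eLpNorm (fun x : ℝ => cauchyHalf f (ε + x * Complex.I)) p ≤ C * eLpNorm f p := by
  have h1 : 1 < p.toReal := by
    rw [← ENNReal.toReal_one]; exact (ENNReal.toReal_lt_toReal (by simp) hp'.ne).2 hp
  rw [← ENNReal.ofReal_toReal hp'.ne]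
  rcases le_or_gt p.toReal 2 with h | h
  · exact exists_eLpNorm_cauchyHalf_le_of_le_two h1 h
  · exact exists_eLpNorm_cauchyHalf_le_of_two_lt h

/-! ### The Fourier transformation on the line. -/

theorem norm_exp_I_mul_mul (a b : ℝ) : ‖Complex.exp (Complex.I * a * b)‖ = 1 := by
  have : Complex.I * a * b = ((a * b : ℝ) : ℂ) * Complex.I := by push_cast; ring
  rw [this, Complex.norm_exp_ofReal_mul_I]

theorem norm_exp_neg_I_mul_mul (a b : ℝ) : ‖Complex.exp (-(Complex.I * a * b))‖ = 1 := by
  rw [Complex.exp_neg, norm_inv, norm_exp_I_mul_mul, inv_one]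

/-- The kernel e^{iξt} has the sign of Mathlib's inverse transformation, whose frequency is measured
in units of 2π. -/
theorem fourierR_eq_fourierInv (φ : ℝ → ℂ) (ξ : ℝ) :
    fourierR φ ξ = 𝓕⁻ φ (ξ / (2 * Real.pi)) := by
  rw [Real.fourierInv_eq', fourierR]
  refine integral_congr_ae (Filter.Eventually.of_forall fun t => ?_)
  simp only [smul_eq_mul, RCLike.inner_apply, conj_trivial]
  congr 2
  push_cast
  field_simp

theorem integrable_fourierR (φ : 𝓢(ℝ, ℂ)) : Integrable (fourierR φ) := by
  have h : Integrable fun ξ : ℝ => (𝓕⁻ φ : 𝓢(ℝ, ℂ)) (ξ / (2 * Real.pi)) :=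
    (𝓕⁻ φ : 𝓢(ℝ, ℂ)).integrable.comp_div (by positivity)
  refine h.congr (Filter.Eventually.of_forall fun ξ => ?_)
  rw [fourierR_eq_fourierInv, SchwartzMap.fourierInv_coe]

/-- The Fourier inversion formula on the Schwartz space. -/
theorem fourierInvR_fourierR (φ : 𝓢(ℝ, ℂ)) : fourierInvR (fourierR φ) = φ := by
  funext t
  have h1 : fourierInvR (fourierR φ) t =
      1 / (2 * (Real.pi : ℂ)) * ∫ ξ : ℝ, (fun η : ℝ => Complex.exp (-(Complex.I * (2 * Real.pi * η : ℝ) * t)) *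
        (𝓕⁻ φ : 𝓢(ℝ, ℂ)) η) (ξ / (2 * Real.pi)) := by
    rw [fourierInvR]
    congr 1
    refine integral_congr_ae (Filter.Eventually.of_forall fun ξ => ?_)
    simp only [fourierR_eq_fourierInv, SchwartzMap.fourierInv_coe]
    congr 3
    rw [mul_div_cancel₀ _ (by positivity)]
  rw [h1, Measure.integral_comp_div (fun η : ℝ =>
    Complex.exp (-(Complex.I * (2 * Real.pi * η : ℝ) * t)) * (𝓕⁻ φ : 𝓢(ℝ, ℂ)) η), abs_of_pos (by positivity)]
  have h2 : (φ : ℝ → ℂ) t = (𝓕 (𝓕⁻ φ : 𝓢(ℝ, ℂ)) : 𝓢(ℝ, ℂ)) t := by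
    rw [FourierTransform.fourier_fourierInv_eq]
  rw [h2, SchwartzMap.fourier_coe, Real.fourier_eq', Complex.real_smul, ← mul_assoc]
  have hpi : (Real.pi : ℂ) ≠ 0 := by exact_mod_cast Real.pi_ne_zero
  have : 1 / (2 * (Real.pi : ℂ)) * ((2 * Real.pi : ℝ) : ℂ) = 1 := by
    push_cast; field_simp
  rw [this, one_mul]
  refine integral_congr_ae (Filter.Eventually.of_forall fun ξ => ?_)
  simp only [smul_eq_mul, RCLike.inner_apply, conj_trivial]
  congr 2
  push_cast
  ring

theorem continuous_fourierR {f : ℝ → ℂ} (hf : Integrable f) : Continuous (fourierR f) := by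
  refine continuous_of_dominated (bound := fun t => ‖f t‖) (fun ξ => ?_) (fun ξ => ?_) hf.norm ?_
  · exact (by fun_prop : Continuous fun t : ℝ => Complex.exp (Complex.I * ξ * t)).aestronglyMeasurable.mul hf.1
  · exact Filter.Eventually.of_forall fun t => by rw [norm_mul, norm_exp_I_mul_mul, one_mul]
  · exact Filter.Eventually.of_forall fun t => by fun_prop

theorem norm_fourierR_le (f : ℝ → ℂ) (ξ : ℝ) : ‖fourierR f ξ‖ ≤ ∫ t, ‖f t‖ := by
  refine (norm_integral_le_integral_norm _).trans (le_of_eq ?_)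
  simp only [norm_mul, norm_exp_I_mul_mul, one_mul]

theorem integrable_exp_neg_mul {f : ℝ → ℂ} (hf : Integrable f) (x : ℝ) :
    Integrable fun ξ : ℝ => Complex.exp (-(Complex.I * ξ * x)) * f ξ := by
  refine hf.norm.mono' ((by fun_prop :
    Continuous fun t : ℝ => Complex.exp (-(Complex.I * t * x))).aestronglyMeasurable.mul hf.1)
    (Filter.Eventually.of_forall fun t => ?_)
  rw [norm_mul, norm_exp_neg_I_mul_mul, one_mul]

theorem continuous_fourierInvR {f : ℝ → ℂ} (hf : Integrable f) : Continuous (fourierInvR f) := by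
  refine continuous_const.mul (continuous_of_dominated (bound := fun t => ‖f t‖)
    (fun ξ => (integrable_exp_neg_mul hf ξ).1) (fun ξ => ?_) hf.norm ?_)
  · exact Filter.Eventually.of_forall fun t => by rw [norm_mul, norm_exp_neg_I_mul_mul, one_mul]
  · exact Filter.Eventually.of_forall fun t => by fun_prop

theorem fourierInvR_add {f g : ℝ → ℂ} (hf : Integrable f) (hg : Integrable g) :
    fourierInvR (fun ξ => f ξ + g ξ) = fun x => fourierInvR f x + fourierInvR g x := by
  funext x
  simp only [fourierInvR, mul_add]
  rw [integral_add (integrable_exp_neg_mul hf x) (integrable_exp_neg_mul hg x), mul_add]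

theorem fourierInvR_const_mul (c : ℂ) (f : ℝ → ℂ) :
    fourierInvR (fun ξ => c * f ξ) = fun x => c * fourierInvR f x := by
  funext x
  simp only [fourierInvR, mul_left_comm _ c]
  rw [integral_const_mul]
  ring

theorem fourierInvR_congr_ae {f g : ℝ → ℂ} (h : f =ᵐ[volume] g) : fourierInvR f = fourierInvR g := by
  funext x
  simp only [fourierInvR]
  congr 1
  refine integral_congr_ae ?_
  filter_upwards [h] with ξ hξ
  rw [hξ]

/-- The transformation `F⁻¹` is continuous from dominated convergence to pointwise convergence. -/
theorem tendsto_fourierInvR {ψ : ℕ → ℝ → ℂ} {ψ' : ℝ → ℂ} {b : ℝ → ℝ} (hb : Integrable b)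
    (hm : ∀ n, AEStronglyMeasurable (ψ n) volume) (hle : ∀ n ξ, ‖ψ n ξ‖ ≤ b ξ)
    (hlim : ∀ ξ, Filter.Tendsto (fun n => ψ n ξ) Filter.atTop (nhds (ψ' ξ))) (x : ℝ) :
    Filter.Tendsto (fun n => fourierInvR (ψ n) x) Filter.atTop (nhds (fourierInvR ψ' x)) := by
  refine Filter.Tendsto.const_mul _ ?_
  refine tendsto_integral_of_dominated_convergence b (fun n => ?_) hb (fun n => ?_) ?_
  · exact (by fun_prop : Continuous fun t : ℝ =>
      Complex.exp (-(Complex.I * t * x))).aestronglyMeasurable.mul (hm n)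
  · exact Filter.Eventually.of_forall fun t => by
      rw [norm_mul, norm_exp_neg_I_mul_mul, one_mul]; exact hle n t
  · exact Filter.Eventually.of_forall fun t => (hlim t).const_mul _

/-- By Fatou's lemma the norm is lower semicontinuous under pointwise limits. Together with
`tendsto_fourierInvR` this carries uniform bounds over to limits of symbols. -/
theorem eLpNorm_le_of_tendsto {g : ℕ → ℝ → ℂ} {g' : ℝ → ℂ} {p C : ℝ≥0∞}
    (hg : ∀ n, AEStronglyMeasurable (g n) volume)
    (hlim : ∀ x, Filter.Tendsto (fun n => g n x) Filter.atTop (nhds (g' x)))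
    (hC : ∀ n, eLpNorm (g n) p ≤ C) : eLpNorm g' p ≤ C := by
  refine (Lp.eLpNorm_lim_le_liminf_eLpNorm hg g' (Filter.Eventually.of_forall hlim)).trans ?_
  refine (Filter.liminf_le_liminf (Filter.Eventually.of_forall hC)).trans ?_
  simp

/-! ### Fourier projections to half lines. -/

/-- Abel regularization of the Fourier projection to the half line gives the Cauchy integral. -/
theorem fourierInvR_indicator_exp_neg {f : ℝ → ℂ} (hf : Integrable f) {ε : ℝ} (hε : 0 < ε) (x : ℝ) :
    fourierInvR (fun ξ => (Ioi (0 : ℝ)).indicator (fun ξ => (Real.exp (-(ε * ξ)) : ℂ)) ξ *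
      fourierR f ξ) x = 1 / (2 * (Real.pi : ℂ)) * cauchyHalf f (ε + x * Complex.I) := by
  rw [fourierInvR]
  congr 1
  have hE : Integrable (fun ξ : ℝ => Real.exp (-(ε * ξ))) (volume.restrict (Ioi 0)) := by
    have := exp_neg_integrableOn_Ioi 0 hε
    simpa [IntegrableOn, neg_mul] using this
  have hint : Integrable (fun z : ℝ × ℝ => Complex.exp (-(Complex.I * z.1 * x)) *
      ((Real.exp (-(ε * z.1)) : ℂ) * (Complex.exp (Complex.I * z.1 * z.2) * f z.2)))
      ((volume.restrict (Ioi 0)).prod volume) := by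
    refine (hE.mul_prod hf.norm).mono' ?_ (Filter.Eventually.of_forall fun z => ?_)
    · refine AEStronglyMeasurable.mul (Continuous.aestronglyMeasurable (by fun_prop)) ?_
      refine AEStronglyMeasurable.mul (Continuous.aestronglyMeasurable (by fun_prop)) ?_
      exact AEStronglyMeasurable.mul (Continuous.aestronglyMeasurable (by fun_prop)) hf.1.comp_snd
    · rw [norm_mul, norm_mul, norm_mul, norm_exp_neg_I_mul_mul, norm_exp_I_mul_mul,
        Complex.norm_of_nonneg (Real.exp_nonneg _), one_mul, one_mul]
  calc ∫ ξ : ℝ, Complex.exp (-(Complex.I * ξ * x)) *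
        ((Ioi (0 : ℝ)).indicator (fun ξ => (Real.exp (-(ε * ξ)) : ℂ)) ξ * fourierR f ξ)
      = ∫ ξ in Ioi (0 : ℝ), Complex.exp (-(Complex.I * ξ * x)) *
        ((Real.exp (-(ε * ξ)) : ℂ) * fourierR f ξ) := by
        rw [← integral_indicator measurableSet_Ioi]
        refine integral_congr_ae (Filter.Eventually.of_forall fun ξ => ?_)
        by_cases h : ξ ∈ Ioi (0 : ℝ)
        · simp only [h, indicator_of_mem]
        · simp only [h, not_false_eq_true, indicator_of_notMem, zero_mul, mul_zero]
    _ = ∫ ξ in Ioi (0 : ℝ), ∫ t : ℝ, Complex.exp (-(Complex.I * ξ * x)) *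
        ((Real.exp (-(ε * ξ)) : ℂ) * (Complex.exp (Complex.I * ξ * t) * f t)) := by
        refine integral_congr_ae (Filter.Eventually.of_forall fun ξ => ?_)
        simp only [fourierR]
        rw [integral_const_mul, integral_const_mul]
    _ = ∫ t : ℝ, ∫ ξ in Ioi (0 : ℝ), Complex.exp (-(Complex.I * ξ * x)) *
        ((Real.exp (-(ε * ξ)) : ℂ) * (Complex.exp (Complex.I * ξ * t) * f t)) :=
        integral_integral_swap hint
    _ = _ := by
        rw [cauchyHalf]
        refine integral_congr_ae (Filter.Eventually.of_forall fun t => ?_)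
        -- After Fubini the ξ-integral is ∫₀^∞ e^{-aξ} dξ = 1/a with a = ε + ix - it, the Cauchy
        -- kernel.
        have h1 := integral_exp_mul_complex_Ioi
          (a := -((ε : ℂ) + x * Complex.I - Complex.I * t)) (by simpa using hε) 0
        have hne := sub_I_mul_ne_zero (w := (ε : ℂ) + x * Complex.I) (by simpa using hε) t
        simp only [Complex.ofReal_zero, mul_zero, Complex.exp_zero, neg_div_neg_eq] at h1
        have h2 : ∀ ξ : ℝ, Complex.exp (-(Complex.I * ξ * x)) *
            ((Real.exp (-(ε * ξ)) : ℂ) * (Complex.exp (Complex.I * ξ * t) * f t)) =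
            f t * Complex.exp (-((ε : ℂ) + x * Complex.I - Complex.I * t) * ξ) := by
          intro ξ
          rw [Complex.ofReal_exp, ← mul_assoc, ← mul_assoc, ← Complex.exp_add, ← Complex.exp_add,
            mul_comm]
          congr 2
          push_cast
          ring
        simp only [h2]
        rw [integral_const_mul, h1, mul_one_div]

/-- Modulation translates the transform without changing |f|, so every half line (c,∞) reduces to
(0,∞) at no cost in the constant. -/
theorem fourierR_modulate (f : ℝ → ℂ) (c ξ : ℝ) :
    fourierR (fun t => Complex.exp (Complex.I * c * t) * f t) ξ = fourierR f (ξ + c) := by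
  simp only [fourierR]
  refine integral_congr_ae (Filter.Eventually.of_forall fun t => ?_)
  simp only
  rw [← mul_assoc, ← Complex.exp_add]
  congr 2
  push_cast
  ring

/-- The Fourier projection to the half line `(0, ∞)` is bounded on `Lᵖ`. -/
theorem exists_eLpNorm_convR_Ioi_zero_le {p : ℝ≥0∞} (hp : 1 < p) (hp' : p < ∞) :
    ∃ C : ℝ≥0∞, C ≠ ∞ ∧ ∀ f : ℝ → ℂ, Integrable f → Integrable (fun t : ℝ => |t| * ‖f t‖) →
      Integrable (fourierR f) →
      eLpNorm (convR ((Ioi (0 : ℝ)).indicator 1) f) p ≤ C * eLpNorm f p := by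
  obtain ⟨C, hC, hb⟩ := exists_eLpNorm_cauchyHalf_le hp hp'
  refine ⟨‖1 / (2 * (Real.pi : ℂ))‖ₑ * C, ENNReal.mul_ne_top enorm_ne_top hC, fun f hf hf1 hF => ?_⟩
  set ψ : ℕ → ℝ → ℂ := fun n ξ => (Ioi (0 : ℝ)).indicator
    (fun ξ => (Real.exp (-((1 / ((n : ℝ) + 1)) * ξ)) : ℂ)) ξ * fourierR f ξ with hψ
  have hψm : ∀ n, AEStronglyMeasurable (ψ n) volume := fun n => by
    refine AEStronglyMeasurable.mul ?_ hF.1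
    exact (Continuous.aestronglyMeasurable (by fun_prop)).indicator measurableSet_Ioi
  have hψb : ∀ n ξ, ‖ψ n ξ‖ ≤ ‖fourierR f ξ‖ := fun n ξ => by
    simp only [hψ]
    by_cases h : ξ ∈ Ioi (0 : ℝ)
    · rw [indicator_of_mem h, norm_mul, Complex.norm_of_nonneg (Real.exp_nonneg _)]
      refine mul_le_of_le_one_left (norm_nonneg _) ?_
      rw [Real.exp_le_one_iff, neg_nonpos]
      have : 0 < ξ := h
      positivity
    · rw [indicator_of_notMem h, zero_mul, norm_zero]
      exact norm_nonneg _
  have hψlim : ∀ ξ, Filter.Tendsto (fun n => ψ n ξ) Filter.atTop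
      (nhds ((Ioi (0 : ℝ)).indicator 1 ξ * fourierR f ξ)) := fun ξ => by
    refine Filter.Tendsto.mul_const _ ?_
    by_cases h : ξ ∈ Ioi (0 : ℝ)
    · simp only [h, indicator_of_mem, Pi.one_apply]
      have h1 : Filter.Tendsto (fun n : ℕ => -((1 / ((n : ℝ) + 1)) * ξ)) Filter.atTop (nhds 0) := by
        simpa using (tendsto_one_div_add_atTop_nhds_zero_nat (𝕜 := ℝ)).mul_const ξ |>.neg
      have h2 := (Complex.continuous_ofReal.comp Real.continuous_exp).continuousAt.tendsto.comp h1
      simpa [Function.comp_def] using h2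
    · simp only [h, not_false_eq_true, indicator_of_notMem]
      exact tendsto_const_nhds
  refine eLpNorm_le_of_tendsto (g := fun n => fourierInvR (ψ n))
    (fun n => (continuous_fourierInvR (hF.norm.mono' (hψm n)
      (Filter.Eventually.of_forall (hψb n)))).aestronglyMeasurable)
    (fun x => tendsto_fourierInvR hF.norm hψm hψb hψlim x) fun n => ?_
  have hε : 0 < 1 / ((n : ℝ) + 1) := by positivity
  have e : fourierInvR (ψ n) = (1 / (2 * (Real.pi : ℂ))) •
      fun x : ℝ => cauchyHalf f ((1 / ((n : ℝ) + 1) : ℝ) + x * Complex.I) := by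
    funext x
    exact fourierInvR_indicator_exp_neg hf hε x
  rw [e, eLpNorm_const_smul, mul_assoc]
  gcongr
  exact hb _ hε f hf hf1

/-- The Fourier projections to half lines are uniformly bounded on `Lᵖ`. -/
theorem exists_eLpNorm_convR_Ioi_le {p : ℝ≥0∞} (hp : 1 < p) (hp' : p < ∞) :
    ∃ C : ℝ≥0∞, C ≠ ∞ ∧ ∀ (c : ℝ) (φ : 𝓢(ℝ, ℂ)),
      eLpNorm (convR ((Ioi c).indicator 1) φ) p ≤ C * eLpNorm φ p := by
  obtain ⟨C, hC, hb⟩ := exists_eLpNorm_convR_Ioi_zero_le hp hp'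
  refine ⟨C, hC, fun c φ => ?_⟩
  have hexp : Continuous fun t : ℝ => Complex.exp (Complex.I * c * t) := by fun_prop
  -- The modulated function is not packaged as a Schwartz function; the bound for (0,∞) needs only
  -- these three integrability facts.
  have h1 : Integrable fun t : ℝ => Complex.exp (Complex.I * c * t) * φ t :=
    φ.integrable.norm.mono' (hexp.mul φ.continuous).aestronglyMeasurable
      (Filter.Eventually.of_forall fun t => by rw [norm_mul, norm_exp_I_mul_mul, one_mul])
  have h2 : Integrable fun t : ℝ => |t| * ‖Complex.exp (Complex.I * c * t) * φ t‖ := by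
    simpa [norm_exp_I_mul_mul] using φ.integrable_pow_mul volume 1
  have h3 : Integrable (fourierR fun t : ℝ => Complex.exp (Complex.I * c * t) * φ t) := by
    have := (integrable_fourierR φ).comp_add_right c
    exact this.congr (Filter.Eventually.of_forall fun ξ => (fourierR_modulate _ _ _).symm)
  have key := hb _ h1 h2 h3
  have e1 : eLpNorm (fun t : ℝ => Complex.exp (Complex.I * c * t) * φ t) p = eLpNorm φ p :=
    eLpNorm_congr_norm_ae (Filter.Eventually.of_forall fun t => by
      rw [norm_mul, norm_exp_I_mul_mul, one_mul])
  rw [e1] at key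
  refine le_trans (le_of_eq ?_) key
  refine eLpNorm_congr_norm_ae (Filter.Eventually.of_forall fun x => ?_)
  have : convR ((Ioi c).indicator 1) φ x = Complex.exp (-(Complex.I * c * x)) *
      convR ((Ioi (0 : ℝ)).indicator 1) (fun t : ℝ => Complex.exp (Complex.I * c * t) * φ t) x := by
    simp only [convR, fourierInvR, fourierR_modulate]
    rw [mul_left_comm]
    congr 1
    rw [← integral_add_right_eq_self (fun ξ : ℝ => Complex.exp (-(Complex.I * ξ * x)) *
      ((Ioi c).indicator 1 ξ * fourierR φ ξ)) c,
      ← integral_const_mul]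
    refine integral_congr_ae (Filter.Eventually.of_forall fun ξ => ?_)
    simp only
    have hi : (Ioi c).indicator (1 : ℝ → ℂ) (ξ + c) = (Ioi (0 : ℝ)).indicator 1 ξ := by
      simp [indicator_apply]
    rw [hi, ← mul_assoc (Complex.exp _) (Complex.exp _), ← Complex.exp_add]
    congr 2
    push_cast
    ring
  rw [this, norm_mul, norm_exp_neg_I_mul_mul, one_mul]

/-! ### Multiplier bounds on the Schwartz space and extension to L_p. -/

theorem convR_congr_ae {a a' : ℝ → ℂ} (h : a =ᵐ[volume] a') (φ : ℝ → ℂ) : convR a φ = convR a' φ :=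
  fourierInvR_congr_ae (h.mul (Filter.EventuallyEq.refl _ (fourierR φ)))

/-- A bounded measurable function for which `F⁻¹ a F` satisfies an `Lᵖ` bound on the Schwartz
space. -/
structure HasMultiplierBound (p : ℝ≥0∞) (a : ℝ → ℂ) : Prop where
  aestronglyMeasurable : AEStronglyMeasurable a volume
  bounded : ∃ M : ℝ, ∀ ξ, ‖a ξ‖ ≤ M
  bound : ∃ C : ℝ≥0∞, C ≠ ∞ ∧ ∀ φ : 𝓢(ℝ, ℂ), eLpNorm (convR a φ) p ≤ C * eLpNorm φ p

theorem integrable_mul_fourierR {a : ℝ → ℂ} (ha : AEStronglyMeasurable a volume)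
    (hb : ∃ M : ℝ, ∀ ξ, ‖a ξ‖ ≤ M) (φ : 𝓢(ℝ, ℂ)) : Integrable fun ξ => a ξ * fourierR φ ξ := by
  obtain ⟨M, hM⟩ := hb
  refine ((integrable_fourierR φ).norm.const_mul M).mono' (ha.mul (integrable_fourierR φ).1)
    (Filter.Eventually.of_forall fun ξ => ?_)
  rw [norm_mul]
  gcongr
  exact hM ξ

theorem isSymbolR_of_bounded {a : ℝ → ℂ} (ha : AEStronglyMeasurable a volume)
    (hb : ∃ M : ℝ, ∀ ξ, ‖a ξ‖ ≤ M) : IsSymbolR a := by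
  rintro _ ⟨φ, rfl⟩
  exact integrable_mul_fourierR ha hb φ

theorem HasMultiplierBound.add {p : ℝ≥0∞} (hp : 1 ≤ p) {a b : ℝ → ℂ} (ha : HasMultiplierBound p a)
    (hb : HasMultiplierBound p b) : HasMultiplierBound p (fun ξ => a ξ + b ξ) := by
  obtain ⟨M, hM⟩ := ha.bounded
  obtain ⟨N, hN⟩ := hb.bounded
  obtain ⟨C, hC, hCb⟩ := ha.bound
  obtain ⟨D, hD, hDb⟩ := hb.bound
  refine ⟨ha.aestronglyMeasurable.add hb.aestronglyMeasurable,
    ⟨M + N, fun ξ => (norm_add_le _ _).trans (add_le_add (hM ξ) (hN ξ))⟩,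
    C + D, ENNReal.add_ne_top.2 ⟨hC, hD⟩, fun φ => ?_⟩
  have h1 := integrable_mul_fourierR ha.aestronglyMeasurable ha.bounded φ
  have h2 := integrable_mul_fourierR hb.aestronglyMeasurable hb.bounded φ
  have e : convR (fun ξ => a ξ + b ξ) φ = convR a φ + convR b φ := by
    simp only [convR, add_mul]
    exact fourierInvR_add h1 h2
  rw [e, add_mul]
  exact (eLpNorm_add_le (continuous_fourierInvR h1).aestronglyMeasurable
    (continuous_fourierInvR h2).aestronglyMeasurable hp).trans (add_le_add (hCb φ) (hDb φ))

theorem convR_const_mul (c : ℂ) (a φ : ℝ → ℂ) : convR (fun ξ => c * a ξ) φ = c • convR a φ := by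
  simp only [convR, mul_assoc]
  exact fourierInvR_const_mul c _

theorem HasMultiplierBound.const_mul {p : ℝ≥0∞} (c : ℂ) {a : ℝ → ℂ}
    (ha : HasMultiplierBound p a) : HasMultiplierBound p (fun ξ => c * a ξ) := by
  obtain ⟨M, hM⟩ := ha.bounded
  obtain ⟨C, hC, hCb⟩ := ha.bound
  refine ⟨ha.aestronglyMeasurable.const_mul c, ⟨‖c‖ * M, fun ξ => ?_⟩,
    ‖c‖ₑ * C, ENNReal.mul_ne_top enorm_ne_top hC, fun φ => ?_⟩
  · rw [norm_mul]; gcongr; exact hM ξ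
  · rw [convR_const_mul, eLpNorm_const_smul, mul_assoc]
    gcongr
    exact hCb φ

theorem convR_one (φ : 𝓢(ℝ, ℂ)) : convR (fun _ => 1) φ = φ := by
  simp only [convR, one_mul]
  exact fourierInvR_fourierR φ

theorem convR_const (c : ℂ) (φ : 𝓢(ℝ, ℂ)) : convR (fun _ => c) φ = c • (φ : ℝ → ℂ) := by
  have := convR_const_mul c (fun _ => 1) φ
  rw [convR_one] at this
  simpa using this

theorem hasMultiplierBound_const (p : ℝ≥0∞) (c : ℂ) : HasMultiplierBound p (fun _ => c) :=
  ⟨aestronglyMeasurable_const, ⟨‖c‖, fun _ => le_rfl⟩, ‖c‖ₑ, enorm_ne_top, fun φ => by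
    rw [convR_const, eLpNorm_const_smul]⟩

theorem fourierR_add (φ ψ : 𝓢(ℝ, ℂ)) :
    fourierR (φ + ψ : 𝓢(ℝ, ℂ)) = fun ξ => fourierR φ ξ + fourierR ψ ξ := by
  funext ξ
  have hi : ∀ χ : 𝓢(ℝ, ℂ), Integrable fun t : ℝ => Complex.exp (Complex.I * ξ * t) * χ t := fun χ =>
    χ.integrable.norm.mono' (Continuous.aestronglyMeasurable
      ((by fun_prop : Continuous fun t : ℝ => Complex.exp (Complex.I * ξ * t)).mul χ.continuous))
      (Filter.Eventually.of_forall fun t => by rw [norm_mul, norm_exp_I_mul_mul, one_mul])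
  simp only [fourierR, add_apply, mul_add]
  exact integral_add (hi φ) (hi ψ)

theorem fourierR_smul (c : ℂ) (φ : 𝓢(ℝ, ℂ)) :
    fourierR (c • φ : 𝓢(ℝ, ℂ)) = fun ξ => c * fourierR φ ξ := by
  funext ξ
  simp only [fourierR, smul_apply, smul_eq_mul, mul_left_comm _ c]
  exact integral_const_mul _ _

/-- Bounded extension from the Schwartz space to `Lᵖ`, `p < ∞`. -/
theorem exists_continuousLinearMap_of_schwartz {p : ℝ≥0∞} [Fact (1 ≤ p)] (hp : p ≠ ∞)
    (f : 𝓢(ℝ, ℂ) →ₗ[ℂ] Lp ℂ p (volume : Measure ℝ)) {C : ℝ}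
    (hC : ∀ φ : 𝓢(ℝ, ℂ), ‖f φ‖ ≤ C * ‖φ.toLp p volume‖) :
    ∃ T : Lp ℂ p (volume : Measure ℝ) →L[ℂ] Lp ℂ p (volume : Measure ℝ),
      ∀ φ : 𝓢(ℝ, ℂ), T (φ.toLp p volume) = f φ :=
  ⟨f.extendOfNorm (SchwartzMap.toLpCLM ℂ ℂ p (volume : Measure ℝ)).toLinearMap, fun φ =>
    LinearMap.extendOfNorm_eq (f := f)
      (e := (SchwartzMap.toLpCLM ℂ ℂ p (volume : Measure ℝ)).toLinearMap)
      (SchwartzMap.denseRange_toLpCLM hp) ⟨C, hC⟩ φ⟩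

/-- The operator `F⁻¹ a F` from the Schwartz space to `Lᵖ`. -/
def convRLinear (p : ℝ≥0∞) (a : ℝ → ℂ)
    (hsym : ∀ φ : 𝓢(ℝ, ℂ), Integrable fun ξ => a ξ * fourierR φ ξ)
    (hmem : ∀ φ : 𝓢(ℝ, ℂ), MemLp (convR a φ) p volume) :
    𝓢(ℝ, ℂ) →ₗ[ℂ] Lp ℂ p (volume : Measure ℝ) where
  toFun φ := (hmem φ).toLp (convR a φ)
  map_add' φ ψ := by
    rw [← MemLp.toLp_add]
    congr 1
    simp only [convR, fourierR_add, mul_add]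
    exact fourierInvR_add (hsym φ) (hsym ψ)
  map_smul' c φ := by
    rw [RingHom.id_apply, ← MemLp.toLp_const_smul]
    congr 1
    simp only [convR, fourierR_smul, mul_left_comm _ c]
    exact fourierInvR_const_mul c _

theorem norm_convRLinear_le {p : ℝ≥0∞} [Fact (1 ≤ p)] {a : ℝ → ℂ}
    (hsym : ∀ φ : 𝓢(ℝ, ℂ), Integrable fun ξ => a ξ * fourierR φ ξ)
    (hmem : ∀ φ : 𝓢(ℝ, ℂ), MemLp (convR a φ) p volume) {C : ℝ≥0∞} (hC : C ≠ ∞)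
    (hb : ∀ φ : 𝓢(ℝ, ℂ), eLpNorm (convR a φ) p ≤ C * eLpNorm φ p) (φ : 𝓢(ℝ, ℂ)) :
    ‖convRLinear p a hsym hmem φ‖ ≤ C.toReal * ‖φ.toLp p volume‖ := by
  have hφ : eLpNorm φ p volume ≠ ∞ := (φ.memLp p volume).2.ne
  have h1 : ‖convRLinear p a hsym hmem φ‖ = (eLpNorm (convR a φ) p).toReal :=
    Lp.norm_toLp _ (hmem φ)
  rw [h1, SchwartzMap.norm_toLp, ← ENNReal.toReal_mul]
  exact ENNReal.toReal_mono (ENNReal.mul_ne_top hC hφ) (hb φ)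

/-- An `Lᵖ` bound on the Schwartz space gives a Fourier multiplier, for `p < ∞`. -/
theorem HasMultiplierBound.mem_fourierMultipliers {p : ℝ≥0∞} [Fact (1 ≤ p)] (hp : p ≠ ∞)
    {a : ℝ → ℂ} (ha : HasMultiplierBound p a) : a ∈ fourierMultipliers p := by
  have hsym := integrable_mul_fourierR ha.aestronglyMeasurable ha.bounded
  obtain ⟨C, hC, hb⟩ := ha.bound
  have hφ : ∀ φ : 𝓢(ℝ, ℂ), eLpNorm φ p volume < ∞ := fun φ => (φ.memLp p volume).2
  have hmem : ∀ φ : 𝓢(ℝ, ℂ), MemLp (convR a φ) p volume := fun φ =>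
    ⟨(continuous_fourierInvR (hsym φ)).aestronglyMeasurable,
      (hb φ).trans_lt (ENNReal.mul_lt_top hC.lt_top (hφ φ))⟩
  obtain ⟨T, hT⟩ := exists_continuousLinearMap_of_schwartz hp (convRLinear p a hsym hmem)
    (norm_convRLinear_le hsym hmem hC hb)
  have hW : ∀ φ ∈ schwartzR, ∃ hφ : MemLp φ p volume, T (hφ.toLp φ) =ᵐ[volume] convR a φ := by
    rintro _ ⟨φ, rfl⟩
    refine ⟨φ.memLp p volume, ?_⟩
    have h2 : T (φ.toLp p volume) = (hmem φ).toLp (convR a φ) := hT φ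
    have h3 := (hmem φ).coeFn_toLp
    rw [← h2] at h3
    exact h3
  exact ⟨isSymbolR_of_bounded ha.aestronglyMeasurable ha.bounded, T, hW⟩

/-! ### Symbols that are monotone or of bounded variation. -/

theorem convR_sum {ι : Type*} (s : Finset ι) (a : ι → ℝ → ℂ) {φ : ℝ → ℂ}
    (h : ∀ k ∈ s, Integrable fun ξ => a k ξ * fourierR φ ξ) :
    convR (fun ξ => ∑ k ∈ s, a k ξ) φ = ∑ k ∈ s, convR (a k) φ := by
  funext x
  simp only [convR, fourierInvR, Finset.sum_apply]
  rw [← Finset.mul_sum, ← integral_finsetSum _ fun k hk => integrable_exp_neg_mul (h k hk) x]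
  simp only [Finset.sum_mul, Finset.mul_sum]

/-- Averages, unlike sums, keep a common bound, so the number of layers approximating a monotone
symbol may grow freely. -/
theorem eLpNorm_average_le {p B : ℝ≥0∞} (hp : 1 ≤ p) (n : ℕ) {g : ℕ → ℝ → ℂ}
    (hg : ∀ k, AEStronglyMeasurable (g k) volume) (hB : ∀ k, eLpNorm (g k) p ≤ B) :
    eLpNorm (((n + 1 : ℕ) : ℂ)⁻¹ • ∑ k ∈ Finset.range (n + 1), g k) p ≤ B := by
  have hnc : ((n + 1 : ℕ) : ℂ) ≠ 0 := by exact_mod_cast n.succ_ne_zero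
  have h2 : eLpNorm (∑ k ∈ Finset.range (n + 1), g k) p ≤ ((n + 1 : ℕ) : ℝ≥0∞) * B := by
    refine (eLpNorm_sum_le (fun k _ => hg k) hp).trans
      ((Finset.sum_le_sum fun k _ => hB k).trans (le_of_eq ?_))
    rw [Finset.sum_const, Finset.card_range, nsmul_eq_mul]
  have h3 : ‖((n + 1 : ℕ) : ℂ)‖ₑ = ((n + 1 : ℕ) : ℝ≥0∞) := by
    rw [← ofReal_norm, Complex.norm_natCast, ENNReal.ofReal_natCast]
  rw [eLpNorm_const_smul, enorm_inv hnc, h3]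
  refine (mul_le_mul_right h2 _).trans (le_of_eq ?_)
  rw [← mul_assoc, ENNReal.inv_mul_cancel (by exact_mod_cast n.succ_ne_zero)
    (ENNReal.natCast_ne_top _), one_mul]

/-- A nonempty upper set that is bounded below is a ray starting at its infimum; whether the
endpoint belongs to it is invisible to `convR`. -/
theorem IsUpperSet.indicator_ae_eq {U : Set ℝ} (hU : IsUpperSet U) :
    U = univ ∨ U = ∅ ∨ ∃ c, (Ioi c).indicator (1 : ℝ → ℂ) =ᵐ[volume] U.indicator 1 := by
  rcases U.eq_empty_or_nonempty with h | h
  · exact Or.inr (Or.inl h)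
  by_cases hb : BddBelow U
  · refine Or.inr (Or.inr ⟨sInf U, ?_⟩)
    have hae : ∀ᵐ x : ℝ, x ≠ sInf U := by simp [ae_iff]
    filter_upwards [hae] with x hx
    have : x ∈ Ioi (sInf U) ↔ x ∈ U := by
      refine ⟨fun hlt => ?_, fun hm => lt_of_le_of_ne (csInf_le hb hm) hx.symm⟩
      obtain ⟨y, hy, hyx⟩ := exists_lt_of_csInf_lt h hlt
      exact hU hyx.le hy
    by_cases hm : x ∈ U
    · rw [indicator_of_mem hm, indicator_of_mem (this.2 hm)]
    · rw [indicator_of_notMem hm, indicator_of_notMem (fun h => hm (this.1 h))]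
  · left
    refine eq_univ_of_forall fun x => ?_
    rw [not_bddBelow_iff] at hb
    obtain ⟨y, hy, hyx⟩ := hb x
    exact hU hyx.le hy

/-- The indicators of the upper sets of `ℝ` are Fourier multipliers with a common bound. -/
theorem exists_eLpNorm_convR_upperSet_le {p : ℝ≥0∞} (hp : 1 < p) (hp' : p < ∞) :
    ∃ C : ℝ≥0∞, C ≠ ∞ ∧ ∀ (U : Set ℝ), IsUpperSet U → ∀ φ : 𝓢(ℝ, ℂ),
      eLpNorm (convR (U.indicator 1) φ) p ≤ C * eLpNorm φ p := by
  obtain ⟨C, hC, hb⟩ := exists_eLpNorm_convR_Ioi_le hp hp'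
  -- The summand 1 is for U = ℝ, where the operator is the identity.
  refine ⟨C + 1, ENNReal.add_ne_top.2 ⟨hC, ENNReal.one_ne_top⟩, fun U hU φ => ?_⟩
  rcases hU.indicator_ae_eq with rfl | rfl | ⟨c, hc⟩
  · have : (univ : Set ℝ).indicator (1 : ℝ → ℂ) = fun _ => 1 := by
      rw [indicator_univ]; rfl
    rw [this, convR_one, add_mul, one_mul]
    exact le_add_self
  · have : (∅ : Set ℝ).indicator (1 : ℝ → ℂ) = fun _ => 0 := by
      rw [indicator_empty]
    rw [this, convR_const, zero_smul, eLpNorm_zero]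
    exact zero_le
  · rw [← convR_congr_ae hc, add_mul]
    exact (hb c φ).trans le_self_add

/-- The k-th layer contains x exactly when k < ⌊n m(x)⌋, and m ≤ 1 ensures that n layers suffice.
For monotone m the layers are upper sets. -/
theorem sum_indicator_eq_floor_div {m : ℝ → ℝ} (h0 : ∀ x, 0 ≤ m x) (h1 : ∀ x, m x ≤ 1) (n : ℕ)
    (x : ℝ) :
    ∑ k ∈ Finset.range n, {y : ℝ | (k : ℝ) + 1 ≤ n * m y}.indicator (1 : ℝ → ℂ) x =
      (⌊n * m x⌋₊ : ℂ) := by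
  have hnm : (0 : ℝ) ≤ n * m x := mul_nonneg (Nat.cast_nonneg n) (h0 x)
  have hle : ⌊n * m x⌋₊ ≤ n := by
    have : (n : ℝ) * m x ≤ n := mul_le_of_le_one_right (Nat.cast_nonneg n) (h1 x)
    exact Nat.floor_le_of_le this
  simp only [indicator_apply, mem_ofPred_eq, Pi.one_apply]
  rw [Finset.sum_boole]
  congr 1
  have : (Finset.range n).filter (fun k : ℕ => (k : ℝ) + 1 ≤ n * m x) =
      Finset.range ⌊n * m x⌋₊ := by
    ext k
    rw [Finset.mem_filter, Finset.mem_range, Finset.mem_range]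
    have h2 : (k : ℝ) + 1 ≤ n * m x ↔ k < ⌊n * m x⌋₊ := by
      rw [← Nat.succ_le_iff, Nat.le_floor_iff hnm]
      push_cast
      rfl
    rw [h2]
    exact ⟨fun h => h.2, fun h => ⟨h.trans_le hle, h⟩⟩
  rw [this, Finset.card_range]

/-- Monotone functions with values in `[0, 1]` are Fourier multipliers. -/
theorem hasMultiplierBound_monotone_of_mem_unitInterval {p : ℝ≥0∞} (hp : 1 < p) (hp' : p < ∞)
    {m : ℝ → ℝ} (hm : Monotone m) (h0 : ∀ x, 0 ≤ m x) (h1 : ∀ x, m x ≤ 1) :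
    HasMultiplierBound p (fun x => (m x : ℂ)) := by
  obtain ⟨C, hC, hb⟩ := exists_eLpNorm_convR_upperSet_le hp hp'
  have hmm : AEStronglyMeasurable (fun x => (m x : ℂ)) volume :=
    (Complex.measurable_ofReal.comp hm.measurable).aestronglyMeasurable
  refine ⟨hmm, ⟨1, fun ξ => ?_⟩, C, hC, fun φ => ?_⟩
  · rw [Complex.norm_of_nonneg (h0 ξ)]; exact h1 ξ
  set U : ℕ → ℕ → Set ℝ := fun n k => {y : ℝ | (k : ℝ) + 1 ≤ ((n + 1 : ℕ) : ℝ) * m y} with hU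
  have hUup : ∀ n k, IsUpperSet (U n k) := fun n k x y hxy hx =>
    le_trans hx (mul_le_mul_of_nonneg_left (hm hxy) (Nat.cast_nonneg _))
  have hUm : ∀ n k, MeasurableSet (U n k) := fun n k =>
    measurableSet_le measurable_const (hm.measurable.const_mul _)
  have hone : ∀ (V : Set ℝ) (ξ : ℝ), ‖V.indicator (1 : ℝ → ℂ) ξ‖ ≤ 1 := fun V ξ => by
    refine (norm_indicator_le_norm_self _ _).trans ?_
    simp
  have hUi : ∀ n k, Integrable fun ξ => (U n k).indicator (1 : ℝ → ℂ) ξ * fourierR φ ξ := fun n k =>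
    integrable_mul_fourierR (aestronglyMeasurable_const.indicator (hUm n k)) ⟨1, hone _⟩ φ
  -- These step functions equal ⌊(n+1) m⌋/(n+1) and converge pointwise to m; using n+1 layers avoids
  -- division by zero.
  set a : ℕ → ℝ → ℂ := fun n ξ => ((n + 1 : ℕ) : ℂ)⁻¹ *
    ∑ k ∈ Finset.range (n + 1), (U n k).indicator (1 : ℝ → ℂ) ξ with ha
  have hafloor : ∀ n ξ, a n ξ = (((n + 1 : ℕ) : ℂ)⁻¹ * (⌊((n + 1 : ℕ) : ℝ) * m ξ⌋₊ : ℂ)) :=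
    fun n ξ => by rw [ha, hU]; simp only; rw [sum_indicator_eq_floor_div h0 h1]
  have habound : ∀ n, eLpNorm (convR (a n) φ) p ≤ C * eLpNorm φ p := by
    intro n
    rw [ha, convR_const_mul, convR_sum _ _ fun k _ => hUi n k]
    exact eLpNorm_average_le hp.le n
      (fun k => (continuous_fourierInvR (hUi n k)).aestronglyMeasurable) fun k => hb _ (hUup n k) φ
  have hanorm : ∀ n ξ, ‖a n ξ‖ ≤ 1 := by
    intro n ξ
    rw [hafloor, norm_mul, norm_inv, Complex.norm_natCast, Complex.norm_natCast]
    have hpos : (0 : ℝ) < ((n + 1 : ℕ) : ℝ) := by exact_mod_cast n.succ_pos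
    rw [inv_mul_le_iff₀ hpos]
    refine (Nat.floor_le (mul_nonneg hpos.le (h0 ξ))).trans ?_
    gcongr
    exact h1 ξ
  have halim : ∀ ξ, Filter.Tendsto (fun n => a n ξ) Filter.atTop (nhds (m ξ : ℂ)) := by
    intro ξ
    have h3 := tendsto_nat_floor_mul_div_atTop (R := ℝ) (h0 ξ)
    have h4 := h3.comp (tendsto_natCast_atTop_atTop.comp (Filter.tendsto_add_atTop_nat 1))
    have h5 := (Complex.continuous_ofReal.tendsto _).comp h4
    refine h5.congr fun n => ?_
    rw [hafloor]
    simp only [Function.comp]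
    rw [mul_comm (m ξ)]
    push_cast
    ring
  have ham : ∀ n, AEStronglyMeasurable (a n) volume := fun n => by
    have : Measurable (a n) := by
      refine measurable_const.mul (Finset.measurable_fun_sum _ fun k _ => ?_)
      exact measurable_one.indicator (hUm n k)
    exact this.aestronglyMeasurable
  refine eLpNorm_le_of_tendsto (g := fun n => convR (a n) φ) (fun n =>
    (continuous_fourierInvR (integrable_mul_fourierR (ham n) ⟨1, hanorm n⟩ φ)).aestronglyMeasurable)
    (fun x => ?_) habound
  refine tendsto_fourierInvR (integrable_fourierR φ).norm
    (fun n => (ham n).mul (integrable_fourierR φ).1) (fun n ξ => ?_)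
    (fun ξ => (halim ξ).mul_const _) x
  rw [Pi.mul_apply, norm_mul]
  exact mul_le_of_le_one_left (norm_nonneg _) (hanorm n ξ)

/-- Bounded monotone functions are Fourier multipliers. -/
theorem hasMultiplierBound_of_monotone {p : ℝ≥0∞} (hp : 1 < p) (hp' : p < ∞)
    {m : ℝ → ℝ} (hm : Monotone m) {M : ℝ} (hM : ∀ x, |m x| ≤ M) :
    HasMultiplierBound p (fun x => (m x : ℂ)) := by
  have hM0 : 0 ≤ M := (abs_nonneg _).trans (hM 0)
  -- The function (m + M)/(2(M + 1)) is monotone with values in [0,1]; M + 1 in place of M covers M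
  -- = 0.
  have hpos : 0 < 2 * (M + 1) := by linarith
  have h := hasMultiplierBound_monotone_of_mem_unitInterval hp hp'
    (m := fun x => (m x + M) / (2 * (M + 1)))
    (fun x y hxy => div_le_div_of_nonneg_right (by linarith [hm hxy]) hpos.le)
    (fun x => div_nonneg (by linarith [(abs_le.1 (hM x)).1]) hpos.le)
    (fun x => (div_le_one hpos).2 (by linarith [(abs_le.1 (hM x)).2]))
  have h2 := (h.const_mul ((2 * (M + 1) : ℝ) : ℂ)).add hp.le (hasMultiplierBound_const p (-(M : ℂ)))
  convert h2 using 2 with x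
  rw [← Complex.ofReal_mul, mul_div_cancel₀ _ hpos.ne']
  push_cast
  ring

/-- Real functions of bounded variation are differences of bounded monotone functions. -/
theorem BoundedVariationOn.exists_monotone_sub_monotone {f : ℝ → ℝ}
    (hf : BoundedVariationOn f univ) :
    ∃ (u v : ℝ → ℝ) (M : ℝ), Monotone u ∧ Monotone v ∧ (∀ x, |u x| ≤ M) ∧ (∀ x, |v x| ≤ M) ∧
      ∀ x, f x = u x - v x := by
  set V := (eVariationOn f univ).toReal with hV
  set u : ℝ → ℝ := fun x => (eVariationOn f (Iic x)).toReal with hu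
  have hfin : ∀ s, eVariationOn f s ≠ ∞ := fun s => hf.mono (subset_univ s)
  have huV : ∀ x, |u x| ≤ V := fun x => by
    rw [abs_of_nonneg ENNReal.toReal_nonneg]
    exact ENNReal.toReal_mono hf (eVariationOn.mono f (subset_univ _))
  -- The increment of f is at most its variation on [x,y], which is at most the increment of u. This
  -- makes u - f monotone.
  have hstep : ∀ x y, x ≤ y → f y - f x ≤ u y - u x := fun x y hxy => by
    have h1 := eVariationOn.add_le_union f (s := Iic x) (t := Icc x y)
      (fun a ha b hb => le_trans ha hb.1)
    rw [Iic_union_Icc_eq_Iic hxy] at h1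
    have h2 := ENNReal.toReal_mono (hfin _) h1
    rw [ENNReal.toReal_add (hfin _) (hfin _)] at h2
    have h3 := BoundedVariationOn.sub_le (hfin (Icc x y)) (right_mem_Icc.2 hxy) (left_mem_Icc.2 hxy)
    simp only [hu]
    linarith
  refine ⟨u, fun x => u x - f x, V + (V + |f 0|), fun x y hxy => ?_, fun x y hxy => ?_,
    fun x => ?_, fun x => ?_, fun x => by ring⟩
  · exact ENNReal.toReal_mono (hfin _) (eVariationOn.mono f (Iic_subset_Iic.2 hxy))
  · have := hstep x y hxy
    simp only
    linarith
  · have := huV x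
    have h4 : 0 ≤ V := ENNReal.toReal_nonneg
    linarith [abs_nonneg (f 0)]
  · have h5 := hf.dist_le (mem_univ x) (mem_univ 0)
    rw [Real.dist_eq] at h5
    have h6 : |f x| ≤ |f x - f 0| + |f 0| := by simpa using abs_add_le (f x - f 0) (f 0)
    have h7 := abs_sub (u x) (f x)
    linarith [huV x]

/-- Functions of bounded variation are Fourier multipliers, `1 < p < ∞`. -/
theorem hasMultiplierBound_of_boundedVariationOn {p : ℝ≥0∞} (hp : 1 < p) (hp' : p < ∞)
    {a : ℝ → ℂ} (ha : BoundedVariationOn a univ) : HasMultiplierBound p a := by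
  have hreal : ∀ f : ℝ → ℝ, BoundedVariationOn f univ → HasMultiplierBound p fun x => (f x : ℂ) := by
    intro f hf
    obtain ⟨u, v, M, hu, hv, huM, hvM, h⟩ := hf.exists_monotone_sub_monotone
    have h2 := (hasMultiplierBound_of_monotone hp hp' hu huM).add hp.le
      ((hasMultiplierBound_of_monotone hp hp' hv hvM).const_mul (-1))
    convert h2 using 2 with x
    rw [h x]
    push_cast
    ring
  have hre : LipschitzWith 1 Complex.re := LipschitzWith.of_dist_le_mul fun z w => by
    rw [NNReal.coe_one, one_mul, dist_eq_norm, dist_eq_norm, ← Complex.sub_re]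
    exact Complex.abs_re_le_norm _
  have him : LipschitzWith 1 Complex.im := LipschitzWith.of_dist_le_mul fun z w => by
    rw [NNReal.coe_one, one_mul, dist_eq_norm, dist_eq_norm, ← Complex.sub_im]
    exact Complex.abs_im_le_norm _
  have h2 := (hreal _ (hre.comp_boundedVariationOn ha)).add hp.le
    ((hreal _ (him.comp_boundedVariationOn ha)).const_mul Complex.I)
  convert h2 using 2 with x
  simp only [Function.comp]
  rw [mul_comm, Complex.re_add_im]

/-! ### The convolution theorem and the Wiener class. -/

/-- The convolution theorem: the symbol `F k` gives the convolution with `k`. -/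
theorem convR_fourierR {k : ℝ → ℂ} (hk : Integrable k) (φ : 𝓢(ℝ, ℂ)) :
    convR (fourierR k) φ = fun x => ∫ t : ℝ, k t * φ (x - t) := by
  funext x
  have hF := integrable_fourierR φ
  have hint : Integrable (fun z : ℝ × ℝ => Complex.exp (-(Complex.I * z.1 * x)) *
      (Complex.exp (Complex.I * z.1 * z.2) * k z.2 * fourierR φ z.1)) (volume.prod volume) := by
    refine (hF.norm.mul_prod hk.norm).mono' ?_ (Filter.Eventually.of_forall fun z => ?_)
    · refine AEStronglyMeasurable.mul (Continuous.aestronglyMeasurable (by fun_prop)) ?_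
      refine AEStronglyMeasurable.mul ?_ hF.1.comp_fst
      exact AEStronglyMeasurable.mul (Continuous.aestronglyMeasurable (by fun_prop)) hk.1.comp_snd
    · rw [norm_mul, norm_mul, norm_mul, norm_exp_neg_I_mul_mul, norm_exp_I_mul_mul, one_mul, one_mul,
        mul_comm]
  simp only [convR, fourierInvR]
  calc 1 / (2 * (Real.pi : ℂ)) * ∫ ξ : ℝ, Complex.exp (-(Complex.I * ξ * x)) *
        (fourierR k ξ * fourierR φ ξ)
      = 1 / (2 * (Real.pi : ℂ)) * ∫ ξ : ℝ, ∫ t : ℝ, Complex.exp (-(Complex.I * ξ * x)) *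
        (Complex.exp (Complex.I * ξ * t) * k t * fourierR φ ξ) := by
        congr 1
        refine integral_congr_ae (Filter.Eventually.of_forall fun ξ => ?_)
        simp only
        rw [integral_const_mul, integral_mul_const]
        rfl
    _ = 1 / (2 * (Real.pi : ℂ)) * ∫ t : ℝ, ∫ ξ : ℝ, Complex.exp (-(Complex.I * ξ * x)) *
        (Complex.exp (Complex.I * ξ * t) * k t * fourierR φ ξ) := by
        rw [integral_integral_swap hint]
    _ = ∫ t : ℝ, k t * fourierInvR (fourierR φ) (x - t) := by
        rw [← integral_const_mul]
        refine integral_congr_ae (Filter.Eventually.of_forall fun t => ?_)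
        simp only [fourierInvR]
        rw [mul_left_comm (k t), ← integral_const_mul (k t)]
        congr 1
        refine integral_congr_ae (Filter.Eventually.of_forall fun ξ => ?_)
        have : Complex.exp (-(Complex.I * ξ * (x - t : ℝ))) =
            Complex.exp (-(Complex.I * ξ * x)) * Complex.exp (Complex.I * ξ * t) := by
          rw [← Complex.exp_add]; congr 1; push_cast; ring
        simp only [this]
        ring
    _ = _ := by rw [fourierInvR_fourierR]

theorem hasMultiplierBound_fourierR {p : ℝ≥0∞} (hp : 1 ≤ p) {k : ℝ → ℂ} (hk : Integrable k) :
    HasMultiplierBound p (fourierR k) := by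
  refine ⟨(continuous_fourierR hk).aestronglyMeasurable, ⟨_, norm_fourierR_le k⟩,
    ∫⁻ t, ‖k t‖ₑ, hk.2.ne, fun φ => ?_⟩
  rw [convR_fourierR hk]
  exact eLpNorm_conv_le hk.1 φ.continuous.aestronglyMeasurable hp

/-- Convolution with an integrable function preserves `Lᵖ`. -/
theorem memLp_conv {p : ℝ≥0∞} (hp : 1 ≤ p) {k f : ℝ → ℂ} (hk : Integrable k)
    (hf : MemLp f p volume) : MemLp (fun x => ∫ t : ℝ, k t * f (x - t)) p volume :=
  ⟨(hk.1.convolution_integrand (ContinuousLinearMap.mul ℂ ℂ) hf.1).integral_prod_right',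
    (eLpNorm_conv_le hk.1 hf.1 hp).trans_lt (ENNReal.mul_lt_top hk.2 hf.2)⟩

/-- For bounded f the convolution integral converges at every x, which makes the linearity of
`convTop` a pointwise computation. -/
theorem integrable_conv_integrand_of_memLp_top {k f : ℝ → ℂ} (hk : Integrable k)
    (hf : MemLp f ∞ volume) (x : ℝ) : Integrable fun t => k t * f (x - t) := by
  have h : MemLp (fun t => f (x - t)) ∞ volume :=
    hf.comp_measurePreserving (Measure.measurePreserving_sub_left volume x)
  exact hk.mul_of_top_left h

/-- Convolution with an integrable function, as an operator on `L^∞`. -/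
def convTop {k : ℝ → ℂ} (hk : Integrable k) :
    Lp ℂ ∞ (volume : Measure ℝ) →L[ℂ] Lp ℂ ∞ (volume : Measure ℝ) :=
  LinearMap.mkContinuous
    { toFun := fun f => (memLp_conv le_top hk (Lp.memLp f)).toLp _
      map_add' := fun f g => by
        rw [← MemLp.toLp_add]
        congr 1
        funext x
        simp only [Pi.add_apply]
        rw [← integral_add (integrable_conv_integrand_of_memLp_top hk (Lp.memLp f) x)
          (integrable_conv_integrand_of_memLp_top hk (Lp.memLp g) x)]
        refine integral_congr_ae ?_
        filter_upwards [ae_comp_sub_left (Lp.coeFn_add f g) x] with t ht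
        rw [ht, Pi.add_apply, mul_add]
      map_smul' := fun c f => by
        rw [RingHom.id_apply, ← MemLp.toLp_const_smul]
        congr 1
        funext x
        simp only [Pi.smul_apply, smul_eq_mul]
        rw [← integral_const_mul]
        refine integral_congr_ae ?_
        filter_upwards [ae_comp_sub_left (Lp.coeFn_smul c f) x] with t ht
        rw [ht, Pi.smul_apply, smul_eq_mul, mul_left_comm] }
    (∫⁻ t, ‖k t‖ₑ).toReal
    (fun f => by
      have hf : eLpNorm f ∞ volume ≠ ∞ := (Lp.memLp f).2.ne
      refine (Lp.norm_toLp _ (memLp_conv le_top hk (Lp.memLp f))).trans_le ?_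
      rw [Lp.norm_def, ← ENNReal.toReal_mul]
      exact ENNReal.toReal_mono (ENNReal.mul_ne_top hk.2.ne hf)
        (eLpNorm_conv_le hk.1 (Lp.memLp f).1 le_top))

theorem coeFn_convTop_toLp {k : ℝ → ℂ} (hk : Integrable k) {f : ℝ → ℂ} (hf : MemLp f ∞ volume) :
    convTop hk (hf.toLp f) =ᵐ[volume] fun x => ∫ t : ℝ, k t * f (x - t) := by
  refine (MemLp.coeFn_toLp (memLp_conv le_top hk (Lp.memLp (hf.toLp f)))).trans
    (Filter.Eventually.of_forall fun x => integral_congr_ae ?_)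
  filter_upwards [ae_comp_sub_left hf.coeFn_toLp x] with t ht
  rw [ht]

/-- The Wiener class consists of Fourier multipliers, `1 ≤ p ≤ ∞`. -/
theorem mem_fourierMultipliers_of_mem_wienerClass {p : ℝ≥0∞} [hp : Fact (1 ≤ p)] {a : ℝ → ℂ}
    (ha : a ∈ wienerClass) : a ∈ fourierMultipliers p := by
  obtain ⟨c, k, hk, h⟩ := ha
  obtain rfl : a = fun ξ => c + fourierR k ξ := funext h
  have hF := hasMultiplierBound_fourierR hp.out hk
  have hb := (hasMultiplierBound_const p c).add hp.out hF
  -- Schwartz functions are not dense in L_∞, so there the extension is given explicitly as c plus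
  -- convolution with k.
  rcases eq_or_ne p ∞ with rfl | hptop
  · refine ⟨isSymbolR_of_bounded hb.aestronglyMeasurable hb.bounded,
      c • ContinuousLinearMap.id ℂ _ + convTop hk, ?_⟩
    rintro _ ⟨φ, rfl⟩
    have hφ : MemLp φ ∞ volume := φ.memLp_top volume
    refine ⟨hφ, ?_⟩
    have e : convR (fun ξ => c + fourierR k ξ) φ =
        fun x => c * φ x + ∫ t : ℝ, k t * φ (x - t) := by
      have h1 := fourierInvR_add (integrable_mul_fourierR (a := fun _ => c)
        aestronglyMeasurable_const ⟨‖c‖, fun _ => le_rfl⟩ φ)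
        (integrable_mul_fourierR hF.aestronglyMeasurable hF.bounded φ)
      have h2 : convR (fun ξ => c + fourierR k ξ) φ =
          fun x => convR (fun _ => c) φ x + convR (fourierR k) φ x := by
        simp only [convR, add_mul]
        exact h1
      rw [h2, convR_const, convR_fourierR hk]
      rfl
    rw [e]
    have h3 : (c • ContinuousLinearMap.id ℂ (Lp ℂ ∞ (volume : Measure ℝ)) + convTop hk)
        (hφ.toLp φ) = c • hφ.toLp φ + convTop hk (hφ.toLp φ) := rfl
    rw [h3]
    filter_upwards [Lp.coeFn_add (c • hφ.toLp φ) (convTop hk (hφ.toLp φ)),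
      Lp.coeFn_smul c (hφ.toLp φ), hφ.coeFn_toLp, coeFn_convTop_toLp hk hφ] with x h4 h5 h6 h7
    rw [h4, Pi.add_apply, h5, Pi.smul_apply, h6, h7, smul_eq_mul]
  · exact hb.mem_fourierMultipliers hptop

/-! ### Change of variables in L_p. -/

/-- Composition with a map scaling the measure, as a bounded operator between `Lᵖ` spaces. -/
theorem exists_compLp {X Y : Type*} [MeasurableSpace X] [MeasurableSpace Y] {μ : Measure X}
    {ν : Measure Y} {p : ℝ≥0∞} [Fact (1 ≤ p)] {g : X → Y} (hg : Measurable g) {r : ℝ≥0∞}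
    (hr0 : r ≠ 0) (hr : r ≠ ∞) (h : μ.map g = r • ν) :
    ∃ J : Lp ℂ p ν →L[ℂ] Lp ℂ p μ, ∀ f : Lp ℂ p ν, J f =ᵐ[μ] (f : Y → ℂ) ∘ g := by
  have hq : Measure.QuasiMeasurePreserving g μ ν :=
    ⟨hg, h ▸ Measure.smul_absolutelyContinuous⟩
  -- For p = ∞ the exponent `(1 / p).toReal` is 0, in agreement with the essential supremum ignoring
  -- the scale r.
  have hnorm : ∀ f : Lp ℂ p ν, eLpNorm ((f : Y → ℂ) ∘ g) p μ = r ^ (1 / p).toReal * eLpNorm f p ν := by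
    intro f
    have hf : AEStronglyMeasurable f (μ.map g) := by
      rw [h]
      exact (Lp.memLp f).1.mono_ac Measure.smul_absolutelyContinuous
    rw [← eLpNorm_map_measure hf hg.aemeasurable, h, eLpNorm_smul_measure_of_ne_zero hr0, smul_eq_mul]
  have hc : r ^ (1 / p).toReal ≠ ∞ := ENNReal.rpow_ne_top_of_nonneg ENNReal.toReal_nonneg hr
  have hmem : ∀ f : Lp ℂ p ν, MemLp ((f : Y → ℂ) ∘ g) p μ := fun f =>
    ⟨(Lp.memLp f).1.comp_quasiMeasurePreserving hq, by
      rw [hnorm]; exact ENNReal.mul_lt_top hc.lt_top (Lp.memLp f).2⟩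
  refine ⟨LinearMap.mkContinuous
    { toFun := fun f => (hmem f).toLp _
      map_add' := fun f f' => by
        rw [← MemLp.toLp_add, MemLp.toLp_eq_toLp_iff]
        exact hq.ae_eq_comp (Lp.coeFn_add f f')
      map_smul' := fun c f => by
        rw [RingHom.id_apply, ← MemLp.toLp_const_smul, MemLp.toLp_eq_toLp_iff]
        exact hq.ae_eq_comp (Lp.coeFn_smul c f) } (r ^ (1 / p).toReal).toReal (fun f => ?_),
    fun f => (hmem f).coeFn_toLp⟩
  refine (Lp.norm_toLp _ (hmem f)).trans_le ?_
  rw [hnorm, ENNReal.toReal_mul, Lp.norm_def]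

/-- Bounded extension is invariant under a change of variables which scales the measure. -/
theorem ExtendsBoundedly.transfer {X Y : Type*} [MeasurableSpace X] [MeasurableSpace Y]
    {μ : Measure X} {ν : Measure Y} {p : ℝ≥0∞} [Fact (1 ≤ p)] (e : X ≃ᵐ Y) {r : ℝ≥0∞}
    (hr0 : r ≠ 0) (hr : r ≠ ∞) (h : μ.map e = r • ν) {S : Set (Y → ℂ)} {W : (Y → ℂ) → (Y → ℂ)}
    {S' : Set (X → ℂ)} {W' : (X → ℂ) → (X → ℂ)} (hS : ∀ φ ∈ S', φ ∘ e.symm ∈ S)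
    (hW : ∀ φ ∈ S', W' φ = W (φ ∘ e.symm) ∘ e) (hext : ExtendsBoundedly ν p S W) :
    ExtendsBoundedly μ p S' W' := by
  obtain ⟨T, hT⟩ := hext
  have h' : ν.map e.symm = r⁻¹ • μ := by
    have h1 : (μ.map e).map e.symm = μ := by
      rw [Measure.map_map e.symm.measurable e.measurable, e.symm_comp_self, Measure.map_id]
    rw [h, Measure.map_smul] at h1
    rw [← h1, smul_smul, ENNReal.inv_mul_cancel hr0 hr, one_smul]
  obtain ⟨J, hJ⟩ := exists_compLp (p := p) e.measurable hr0 hr h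
  obtain ⟨J', hJ'⟩ := exists_compLp (p := p) e.symm.measurable (ENNReal.inv_ne_zero.2 hr)
    (ENNReal.inv_ne_top.2 hr0) h'
  have hq : Measure.QuasiMeasurePreserving e μ ν :=
    ⟨e.measurable, h ▸ Measure.smul_absolutelyContinuous⟩
  have hq' : Measure.QuasiMeasurePreserving e.symm ν μ :=
    ⟨e.symm.measurable, h' ▸ Measure.smul_absolutelyContinuous⟩
  refine ⟨J.comp (T.comp J'), fun φ hφ => ?_⟩
  obtain ⟨hm, hTφ⟩ := hT _ (hS φ hφ)
  -- Nothing is assumed about functions in S'; measurability, and then finiteness of the norm, are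
  -- read off from φ ∘ e⁻¹ ∈ S.
  have hae : AEStronglyMeasurable φ μ := by
    have := hm.1.comp_quasiMeasurePreserving hq
    rwa [Function.comp_assoc, e.symm_comp_self, Function.comp_id] at this
  have hmφ : MemLp φ p μ := by
    refine ⟨hae, ?_⟩
    have h2 : eLpNorm (φ ∘ e.symm) p ν = r⁻¹ ^ (1 / p).toReal * eLpNorm φ p μ := by
      rw [← eLpNorm_map_measure (h' ▸ hae.mono_ac Measure.smul_absolutelyContinuous)
        e.symm.measurable.aemeasurable, h',
        eLpNorm_smul_measure_of_ne_zero (ENNReal.inv_ne_zero.2 hr), smul_eq_mul]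
    have h3 := hm.2
    rw [h2] at h3
    have h4 : r⁻¹ ^ (1 / p).toReal ≠ 0 := by
      rw [ENNReal.inv_rpow]
      exact ENNReal.inv_ne_zero.2 (ENNReal.rpow_ne_top_of_nonneg ENNReal.toReal_nonneg hr)
    exact ENNReal.lt_top_of_mul_ne_top_right h3.ne h4
  refine ⟨hmφ, ?_⟩
  have h5 : J' (hmφ.toLp φ) = hm.toLp (φ ∘ e.symm) := by
    refine Lp.ext ((hJ' _).trans ((hq'.ae_eq_comp hmφ.coeFn_toLp).trans hm.coeFn_toLp.symm))
  have h6 : (J.comp (T.comp J')) (hmφ.toLp φ) = J (T (hm.toLp (φ ∘ e.symm))) := by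
    rw [← h5]; rfl
  rw [h6, hW φ hφ]
  exact (hJ _).trans (hq.ae_eq_comp hTφ)

/-! ### Passage between G and ℝ. -/

theorem Real.hasDerivAt_tanh' (t : ℝ) : HasDerivAt Real.tanh (1 - Real.tanh t ^ 2) t := by
  have hc := (Real.cosh_pos t).ne'
  have h := (Real.hasDerivAt_sinh t).div (Real.hasDerivAt_cosh t) hc
  have e : (Real.sinh / Real.cosh : ℝ → ℝ) = Real.tanh := by
    funext s; rw [Pi.div_apply, Real.tanh_eq_sinh_div_cosh]
  rw [e] at h
  refine h.congr_deriv ?_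
  rw [Real.tanh_eq_sinh_div_cosh]
  field_simp

theorem tOfG_eq_artanh (x : GInterval) : tOfG x = Real.artanh x := by
  rw [tOfG, Real.artanh_eq_half_log (Ioo_subset_Icc_self x.2)]

theorem tOfG_xOfR (t : ℝ) : tOfG (xOfR t) = t := by
  rw [tOfG_eq_artanh]; exact Real.artanh_tanh t

theorem xOfR_tOfG (x : GInterval) : xOfR (tOfG x) = x := by
  apply Subtype.ext
  rw [tOfG_eq_artanh]
  exact Real.tanh_artanh x.2

/-- The diffeomorphism `t : G → ℝ`, as a measurable equivalence. -/
def tEquiv : GInterval ≃ᵐ ℝ where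
  toFun := tOfG
  invFun := xOfR
  left_inv := xOfR_tOfG
  right_inv := tOfG_xOfR
  measurable_toFun := by
    have : Measurable tOfG := by
      unfold tOfG
      fun_prop
    exact this
  measurable_invFun := by
    have : Measurable Real.tanh :=
      (continuous_iff_continuousAt.2 fun t => (Real.hasDerivAt_tanh' t).continuousAt).measurable
    exact this.subtype_mk

/-- The measure `dG` is the pull back of the Lebesgue measure. -/
theorem map_tEquiv_haarG : haarG.map tEquiv = volume := by
  ext s hs
  rw [tEquiv.map_apply, haarG, withDensity_apply _ (tEquiv.measurable hs)]
  have hsub := setLIntegral_subtype (μ := (volume : Measure ℝ)) (s := Ioo (-1 : ℝ) 1)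
    measurableSet_Ioo (tEquiv ⁻¹' s) fun x => ENNReal.ofReal (1 / (1 - x ^ 2))
  rw [hsub]
  have himg : Subtype.val '' (tEquiv ⁻¹' s) = Real.tanh '' s := by
    rw [← MeasurableEquiv.image_symm, image_image]
    rfl
  rw [himg, lintegral_image_eq_lintegral_abs_deriv_mul hs
    (fun t _ => (Real.hasDerivAt_tanh' t).hasDerivWithinAt) Real.tanh_injective.injOn]
  -- The Jacobian 1 - tanh² t of the substitution cancels the density of dG.
  have hone : ∀ t : ℝ, ENNReal.ofReal |1 - Real.tanh t ^ 2| *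
      ENNReal.ofReal (1 / (1 - Real.tanh t ^ 2)) = 1 := by
    intro t
    have h0 : 0 < 1 - Real.tanh t ^ 2 := by
      nlinarith [Real.neg_one_lt_tanh t, Real.tanh_lt_one t]
    rw [abs_of_pos h0, ← ENNReal.ofReal_mul h0.le, mul_one_div_cancel h0.ne', ENNReal.ofReal_one]
  simp only [hone]
  rw [setLIntegral_one]

theorem measurePreserving_tOfG : MeasurePreserving tEquiv haarG volume :=
  ⟨tEquiv.measurable, map_tEquiv_haarG⟩

theorem charG_eq_exp (x : GInterval) (ξ : ℝ) :
    charG x ξ = Complex.exp (Complex.I * (2 * ξ : ℝ) * tOfG x) := by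
  have hpos : 0 < (1 + (x : ℝ)) / (1 - (x : ℝ)) :=
    div_pos (by linarith [x.2.1]) (by linarith [x.2.2])
  rw [charG, Complex.cpow_def_of_ne_zero (by exact_mod_cast hpos.ne'), ← Complex.ofReal_log hpos.le,
    tOfG]
  congr 1
  push_cast
  ring

theorem fourierG_eq (φ₀ : GInterval → ℂ) (ξ : ℝ) : fourierG φ₀ ξ = fourierR (xPull φ₀) (2 * ξ) := by
  have h := measurePreserving_tOfG.integral_comp' (g := fun t : ℝ =>
    Complex.exp (Complex.I * (2 * ξ : ℝ) * t) * xPull φ₀ t)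
  rw [fourierR, ← h, fourierG]
  refine integral_congr_ae (Filter.Eventually.of_forall fun x => ?_)
  have h1 : xPull φ₀ (tEquiv x) = φ₀ x := congrArg φ₀ (xOfR_tOfG x)
  simp only [h1, charG_eq_exp]
  rfl

/-- The characters of G have frequency 2ξ in the variable t. Rescaling ξ halves the argument of a,
and its Jacobian accounts for 1/π in place of 1/(2π). -/
theorem convG_eq (a : ℝ → ℂ) (φ₀ : GInterval → ℂ) :
    convG a φ₀ = tPull (convR (fun ξ => a (ξ / 2)) (xPull φ₀)) := by
  funext x
  have h := Measure.integral_comp_div (fun ξ : ℝ => Complex.exp (-(Complex.I * (2 * ξ : ℝ) * tOfG x)) *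
    (a ξ * fourierR (xPull φ₀) (2 * ξ))) 2
  have h2 : ∫ ξ : ℝ, Complex.exp (-(Complex.I * ξ * tOfG x)) *
      (a (ξ / 2) * fourierR (xPull φ₀) ξ) = (2 : ℂ) * ∫ ξ : ℝ,
        Complex.exp (-(Complex.I * (2 * ξ : ℝ) * tOfG x)) * (a ξ * fourierR (xPull φ₀) (2 * ξ)) := by
    rw [abs_of_pos two_pos, Complex.real_smul] at h
    refine Eq.trans ?_ (h.trans (by norm_num))
    refine integral_congr_ae (Filter.Eventually.of_forall fun ξ => ?_)
    simp only
    rw [mul_div_cancel₀ ξ two_ne_zero]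
  simp only [convG, fourierInvG, tPull, convR, fourierInvR]
  rw [h2, ← mul_assoc]
  congr 1
  · field_simp
  · refine integral_congr_ae (Filter.Eventually.of_forall fun ξ => ?_)
    simp only [fourierG_eq, charG_eq_exp]
    congr 2
    push_cast
    ring

theorem xPull_tPull (φ : ℝ → ℂ) : xPull (tPull φ) = φ := funext fun t => congrArg φ (tOfG_xOfR t)

theorem xPull_mem_schwartzR {φ₀ : GInterval → ℂ} (h : φ₀ ∈ schwartzG) : xPull φ₀ ∈ schwartzR := by
  obtain ⟨φ, hφ, rfl⟩ := h
  rwa [xPull_tPull]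

theorem isSymbolG_iff (a : ℝ → ℂ) : IsSymbolG a ↔ IsSymbolR fun ξ => a (ξ / 2) := by
  have key : ∀ φ₀ : GInterval → ℂ, (Integrable fun ξ : ℝ => a ξ * fourierG φ₀ ξ) ↔
      Integrable fun ξ : ℝ => a (ξ / 2) * fourierR (xPull φ₀) ξ := by
    intro φ₀
    have e : (fun ξ : ℝ => a ξ * fourierG φ₀ ξ) =
        fun ξ => (fun η : ℝ => a (η / 2) * fourierR (xPull φ₀) η) (2 * ξ) := by
      funext ξ
      simp only [fourierG_eq]
      rw [mul_div_cancel_left₀ ξ two_ne_zero]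
    rw [e]
    exact integrable_comp_mul_left_iff (fun η : ℝ => a (η / 2) * fourierR (xPull φ₀) η) two_ne_zero
  refine ⟨fun h φ hφ => ?_, fun h φ₀ hφ₀ => (key φ₀).2 (h _ (xPull_mem_schwartzR hφ₀))⟩
  have := (key _).1 (h (tPull φ) ⟨φ, hφ, rfl⟩)
  rwa [xPull_tPull] at this

theorem isBoundedConvG_iff_div_two (p : ℝ≥0∞) [Fact (1 ≤ p)] (a : ℝ → ℂ) :
    IsBoundedConvG p a ↔ (fun ξ => a (ξ / 2)) ∈ fourierMultipliers p := by
  have hmap : haarG.map tEquiv = (1 : ℝ≥0∞) • volume := by rw [one_smul, map_tEquiv_haarG]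
  have hmap' : (volume : Measure ℝ).map tEquiv.symm = (1 : ℝ≥0∞) • haarG := by
    rw [one_smul]; exact measurePreserving_tOfG.symm.map_eq
  refine and_congr (isSymbolG_iff a) ⟨fun h => ?_, fun h => ?_⟩
  · have hS : ∀ φ ∈ schwartzR, φ ∘ tEquiv.symm.symm ∈ schwartzG := fun φ hφ => ⟨φ, hφ, rfl⟩
    refine h.transfer tEquiv.symm one_ne_zero ENNReal.one_ne_top hmap' hS fun φ _ => ?_
    have h1 : (φ ∘ tEquiv.symm.symm : GInterval → ℂ) = tPull φ := rfl
    rw [h1, convG_eq, xPull_tPull]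
    exact (xPull_tPull _).symm
  · refine h.transfer tEquiv one_ne_zero ENNReal.one_ne_top hmap
      (fun φ hφ => xPull_mem_schwartzR hφ) fun φ _ => ?_
    exact convG_eq a φ

/-! ### Dilation invariance and the characterization of boundedness. -/

theorem fourierR_comp_div (φ : ℝ → ℂ) {c : ℝ} (hc : 0 < c) (ξ : ℝ) :
    fourierR (fun t => φ (t / c)) ξ = c * fourierR φ (c * ξ) := by
  have h := Measure.integral_comp_div (fun t : ℝ =>
    Complex.exp (Complex.I * (c * ξ : ℝ) * t) * φ t) c
  rw [abs_of_pos hc, Complex.real_smul] at h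
  rw [fourierR, fourierR, ← h]
  refine integral_congr_ae (Filter.Eventually.of_forall fun t => ?_)
  simp only
  congr 2
  have : (c : ℂ) ≠ 0 := by exact_mod_cast hc.ne'
  push_cast
  field_simp

/-- Dilating the symbol conjugates the operator by a dilation: the Jacobian c of the frequency
substitution is exactly the factor in the transform of φ(t/c). -/
theorem convR_comp_div (a φ : ℝ → ℂ) {c : ℝ} (hc : 0 < c) (x : ℝ) :
    convR (fun ξ => a (ξ / c)) φ x = convR a (fun t => φ (t / c)) (c * x) := by
  have h := Measure.integral_comp_div (fun ξ : ℝ => Complex.exp (-(Complex.I * ξ * (c * x : ℝ))) *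
    (a ξ * fourierR φ (c * ξ))) c
  rw [abs_of_pos hc, Complex.real_smul] at h
  simp only [convR, fourierInvR]
  congr 1
  have hcc : (c : ℂ) ≠ 0 := by exact_mod_cast hc.ne'
  calc ∫ ξ : ℝ, Complex.exp (-(Complex.I * ξ * x)) * (a (ξ / c) * fourierR φ ξ)
      = ∫ ξ : ℝ, Complex.exp (-(Complex.I * (ξ / c : ℝ) * (c * x : ℝ))) *
        (a (ξ / c) * fourierR φ (c * (ξ / c))) := by
        refine integral_congr_ae (Filter.Eventually.of_forall fun ξ => ?_)
        simp only
        rw [mul_div_cancel₀ ξ hc.ne']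
        congr 2
        push_cast
        field_simp
    _ = _ := h
    _ = _ := by
        rw [← integral_const_mul]
        refine integral_congr_ae (Filter.Eventually.of_forall fun ξ => ?_)
        simp only [fourierR_comp_div φ hc]
        ring

theorem comp_div_mem_schwartzR {φ : ℝ → ℂ} (hφ : φ ∈ schwartzR) {c : ℝ} (hc : c ≠ 0) :
    (fun t => φ (t / c)) ∈ schwartzR := by
  obtain ⟨f, rfl⟩ := hφ
  refine ⟨SchwartzMap.compCLMOfContinuousLinearEquiv ℂ
    (ContinuousLinearEquiv.unitsEquivAut ℝ (Units.mk0 c hc)⁻¹) f, ?_⟩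
  funext t
  simp [div_eq_mul_inv]

/-- The multiplier classes are invariant under dilations. -/
theorem comp_div_mem_fourierMultipliers {p : ℝ≥0∞} [Fact (1 ≤ p)] {a : ℝ → ℂ}
    (ha : a ∈ fourierMultipliers p) {c : ℝ} (hc : 0 < c) :
    (fun ξ => a (ξ / c)) ∈ fourierMultipliers p := by
  refine ⟨fun φ hφ => ?_, ?_⟩
  · have h1 := ha.1 _ (comp_div_mem_schwartzR hφ hc.ne')
    have h2 := (h1.comp_div hc.ne').const_mul ((c : ℂ)⁻¹)
    refine h2.congr (Filter.Eventually.of_forall fun ξ => ?_)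
    have hcc : (c : ℂ) ≠ 0 := by exact_mod_cast hc.ne'
    simp only [fourierR_comp_div φ hc]
    rw [mul_div_cancel₀ ξ hc.ne']
    field_simp
  · have hmap : (volume : Measure ℝ).map (MeasurableEquiv.mulLeft₀ c hc.ne') =
        ENNReal.ofReal |c⁻¹| • volume := Real.map_volume_mul_left hc.ne'
    have hsymm : ∀ φ : ℝ → ℂ, φ ∘ (MeasurableEquiv.mulLeft₀ c hc.ne').symm = fun t => φ (t / c) := by
      intro φ
      funext t
      simp [div_eq_inv_mul]
    refine ha.2.transfer (MeasurableEquiv.mulLeft₀ c hc.ne') ?_ ENNReal.ofReal_ne_top hmap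
      (fun φ hφ => ?_) fun φ _ => ?_
    · rw [ne_eq, ENNReal.ofReal_eq_zero, not_le]
      exact abs_pos.2 (inv_ne_zero hc.ne')
    · rw [hsymm]; exact comp_div_mem_schwartzR hφ hc.ne'
    · rw [hsymm]
      funext x
      exact convR_comp_div a φ hc x

theorem isBoundedConvG_iff (p : ℝ≥0∞) [Fact (1 ≤ p)] (a : ℝ → ℂ) :
    IsBoundedConvG p a ↔ a ∈ fourierMultipliers p := by
  rw [isBoundedConvG_iff_div_two]
  refine ⟨fun h => ?_, fun h => comp_div_mem_fourierMultipliers h two_pos⟩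
  -- The dilation by 1/2 undoes ξ ↦ ξ/2, which gives the converse implication.
  have h2 := comp_div_mem_fourierMultipliers h (c := 1 / 2) (by norm_num)
  have e : (fun ξ : ℝ => a (ξ / (1 / 2) / 2)) = a := by
    funext ξ; congr 1; ring
  rwa [e] at h2

end

theorem theorem3p2 :
    -- boundedness on `L_p(G, dG)` is characterized by the multiplier class, `1 ≤ p ≤ ∞`
    (∀ (p : ℝ≥0∞) [Fact (1 ≤ p)] (a : ℝ → ℂ),
      IsBoundedConvG p a ↔ a ∈ fourierMultipliers p) ∧
    -- transfer: `W⁰_{G,a₀} = t_* W⁰_a x_*` with `a₀(ξ) = a(2ξ)`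
    (∀ a : ℝ → ℂ, IsSymbolR a →
      IsSymbolG (fun ξ => a (2 * ξ)) ∧
      ∀ φ₀ ∈ schwartzG, convG (fun ξ => a (2 * ξ)) φ₀ = tPull (convR a (xPull φ₀))) ∧
    -- symbols of bounded variation, `1 < p < ∞`
    (∀ (p : ℝ≥0∞) [Fact (1 ≤ p)] (a : ℝ → ℂ), 1 < p → p < ∞ →
      BoundedVariationOn a Set.univ → IsBoundedConvG p a) ∧
    -- symbols of the Wiener class, `1 ≤ p ≤ ∞`
    (∀ (p : ℝ≥0∞) [Fact (1 ≤ p)] (a : ℝ → ℂ),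
      a ∈ wienerClass → IsBoundedConvG p a) := by
  have e : ∀ a : ℝ → ℂ, (fun ξ : ℝ => a (2 * (ξ / 2))) = a := fun a => by
    funext ξ; rw [mul_div_cancel₀ ξ two_ne_zero]
  refine ⟨fun p _ a => isBoundedConvG_iff p a, fun a ha => ⟨?_, fun φ₀ _ => ?_⟩,
    fun p _ a hp hp' ha => ?_, fun p _ a ha => ?_⟩
  · rw [isSymbolG_iff, e]; exact ha
  · rw [convG_eq, e]
  · exact (isBoundedConvG_iff p a).2
      ((hasMultiplierBound_of_boundedVariationOn hp hp' ha).mem_fourierMultipliers hp'.ne)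
  · exact (isBoundedConvG_iff p a).2 (mem_fourierMultipliers_of_mem_wienerClass ha)
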